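/- **Setting.** Let $0<\mu<1$ and $E\in\mathbb R$. Let $S(x,y)=\sum_{k=1}^{n-1}a_kx^{n-k}y^k$ be a real homogeneous polynomial of degree $n$ whose mixed second derivative factors as $$S''_{xy}(x,y)=c\prod_{l=1}^{s}(y-\alpha_l x)^{m_l}\prod_{l=1}^{r}Q_l(x,y),\qquad \sum_{l} m_l+2r=n-2,$$ with $c\neq0$, real $\alpha_l\ne 0$, and positive definite real quadratic forms $Q_l$. Let $K$ be a complex function on $\mathbb R^2$ that is $C^2$ off the diagonal and satisfies, for $x\ne y$ and $i=1,2$, $$|K(x,y)|\le E|x-y|^{-\mu},\quad |\partial_y^iK(x,y)|\le E|x-y|^{-\mu-i},\quad |\partial_x^iK(x,y)|\le E|x-y|^{-\mu-i}.$$ Let $\psi\in C_0^\infty(\mathbb R^2)$. Fix $\phi\in C_0^\infty(\mathbb R)$ with $\phi=1$ on $|t|\le\frac12$ and $\phi=0$ on $|t|\ge1$, and $\Psi\in C_0^\infty(\mathbb R)$ supported in $[\frac12,2]$ with $\sum_{l\in\mathbb Z}\Psi(2^lt)=1$ for $t>0$. Let $\mathcal K$ be a real number that is large depending on the $\alpha_l$,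 namely $$2^{\mathcal K}\ge 8,\qquad 2^{\mathcal K}\ge 8|\alpha_l|,\qquad 2^{\mathcal K}\ge 8|\alpha_l|^{-1}\qquad(1\le l\le s),$$ and write $j\gg k$ for $j>k+\mathcal K$ and $j\ll k$ for $j<k-\mathcal K$ ($j,k\in\mathbb Z$). For $\lambda>0$ and $z\in\mathbb C$ put $$D_{j,k}f(x)=\int_{\mathbb R}e^{i\lambda S(x,y)}K(x,y)\,|S''_{xy}(x,y)|^{z}\,\bigl[1-\phi\bigl((x-y)\lambda^{1/n}\bigr)\bigr]\Psi(2^jx)\Psi(2^ky)\psi(x,y)f(y)\,dy,$$ $$T_Y^zf=\sum_{j\gg k}D_{j,k}f,\qquad T_X^zf=\sum_{j\ll k}D_{j,k}f .$$ **Theorem 3.1.** Let $\operatorname{Re}z=\frac12$. For every $f\in L^2(\mathbb R)$ and every $x$, the integrals and sums defining $T_Y^zf(x)$ and $T_X^zf(x)$ converge absolutely, the resulting functions belong to $L^2(\mathbb R)$, and for all $\lambda>0$ $$\|T_Y^zf\|_{L^2}\le C\,\lambda^{\frac{\mu}{n}-\frac12}\|f\|_{L^2},\qquad \|T_X^zf\|_{L^2}\le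 C\,\lambda^{\frac{\mu}{n}-\frac12}\|f\|_{L^2}.$$ Here $C>0$ depends only on $E,\mathcal K,\psi,n,z$, on $\mu$ and the fixed cut-offs $\phi,\Psi$, and on the forms $Q_l$; in particular not on $\lambda$, $f$, $K$, $c$, the $\alpha_l$ or the $m_l$. If $\mathcal K$ is moreover so large that $8^2Q_l(1,0)\le 4^{\mathcal K}Q_l(0,1)$ and $8^2Q_l(0,1)\le 4^{\mathcal K}Q_l(1,0)$ for all $l$, then $C$ can be taken independent of the forms $Q_l$ too. -/

import Mathlib

open MeasureTheory
open scoped ContDiff ENNReal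

noncomputable section

/-- The homogeneous polynomial phase `S(x,y) = ∑_{k=1}^{n-1} a_k x^{n-k} y^k`. -/
def phase (n : ℕ) (a : ℕ → ℝ) (x y : ℝ) : ℝ :=
  ∑ k ∈ Finset.Icc 1 (n - 1), a k * x ^ (n - k) * y ^ k

/-- The mixed second derivative `S''_{xy}`. -/
def mixedHessian (S : ℝ → ℝ → ℝ) (x y : ℝ) : ℝ :=
  deriv (fun u => deriv (fun v => S u v) y) x

/-- `S''_{xy}(x,y) = c ∏ (y - α_l x)^{m_l} ∏ Q_l(x,y)` with `c` and all `α_l` nonzero, every `Q_l`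
a positive definite quadratic form, and total degree `∑ m_l + 2 r = n - 2`. -/
structure HessianFactors (n : ℕ) (S : ℝ → ℝ → ℝ) (c : ℝ) {s r : ℕ} (α : Fin s → ℝ)
    (m : Fin s → ℕ) (Q : Fin r → QuadraticForm ℝ (ℝ × ℝ)) : Prop where
  c_ne : c ≠ 0
  α_ne : ∀ l, α l ≠ 0
  posDef : ∀ l, (Q l).PosDef
  degree : (∑ l, m l) + 2 * r + 2 = n
  eq : ∀ x y : ℝ, mixedHessian S x y =
    c * (∏ l, (y - α l * x) ^ m l) * ∏ l, Q l (x, y)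

/-- `K` is `C²` off the diagonal with `|K| ≤ E |x-y|^{-μ}`, `|∂_y^i K| ≤ E |x-y|^{-μ-i}` and
`|∂_x^i K| ≤ E |x-y|^{-μ-i}` for `i = 1, 2`. -/
structure IsSingularKernel (μ E : ℝ) (K : ℝ → ℝ → ℂ) : Prop where
  contDiffOn : ContDiffOn ℝ 2 (fun p : ℝ × ℝ => K p.1 p.2) {p | p.1 ≠ p.2}
  bound : ∀ x y, x ≠ y → ‖K x y‖ ≤ E * |x - y| ^ (-μ)
  bound_y : ∀ i : ℕ, i = 1 ∨ i = 2 → ∀ x y, x ≠ y →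
    ‖iteratedDeriv i (fun v => K x v) y‖ ≤ E * |x - y| ^ (-μ - i)
  bound_x : ∀ i : ℕ, i = 1 ∨ i = 2 → ∀ x y, x ≠ y →
    ‖iteratedDeriv i (fun u => K u y) x‖ ≤ E * |x - y| ^ (-μ - i)

/-- A smooth cut-off with `φ = 1` on `|t| ≤ 1/2` and `φ = 0` on `|t| ≥ 1`. -/
structure IsCutoff (φ : ℝ → ℝ) : Prop where
  smooth : ContDiff ℝ ∞ φ
  eq_zero : ∀ t, 1 ≤ |t| → φ t = 0
  eq_one : ∀ t, |t| ≤ 1 / 2 → φ t = 1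

/-- A smooth function supported in `[1/2, 2]` with `∑_{l ∈ ℤ} Ψ(2^l t) = 1` for `t > 0`. -/
structure IsDyadicPartition (Ψ : ℝ → ℝ) : Prop where
  smooth : ContDiff ℝ ∞ Ψ
  supp : tsupport Ψ ⊆ Set.Icc (1 / 2) 2
  hasSum : ∀ t, 0 < t → HasSum (fun l : ℤ => Ψ ((2 : ℝ) ^ l * t)) 1

/-- `𝒦` is large enough for the lines `y = α_l x` and for the diagonal `y = x`: wherever
`Ψ(2^j x) Ψ(2^k y) ≠ 0`, one has `|α_l x| ≤ |y| / 2` and `|x| ≤ |y| / 2` if `j > k + 𝒦`, and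
`|y| ≤ |α_l x| / 2` and `|y| ≤ |x| / 2` if `j < k - 𝒦`. -/
def DominatesLines (𝒦 : ℝ) {s : ℕ} (α : Fin s → ℝ) : Prop :=
  8 ≤ (2 : ℝ) ^ 𝒦 ∧ ∀ l, 8 * |α l| ≤ (2 : ℝ) ^ 𝒦 ∧ 8 ≤ (2 : ℝ) ^ 𝒦 * |α l|

/-- The same largeness for the two complex lines `y = w x`, `y = w̄ x` on which a definite form
`Q` vanishes; here `|w|² = Q(1,0) / Q(0,1)`. -/
def DominatesForms (𝒦 : ℝ) {r : ℕ} (Q : Fin r → QuadraticForm ℝ (ℝ × ℝ)) : Prop :=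
  ∀ l, 8 ^ 2 * Q l (1, 0) ≤ ((2 : ℝ) ^ 𝒦) ^ 2 * Q l (0, 1) ∧
    8 ^ 2 * Q l (0, 1) ≤ ((2 : ℝ) ^ 𝒦) ^ 2 * Q l (1, 0)

/-- The kernel of the piece `(j,k)` of the damped operators:
`e^{iλS} K |S''_{xy}|^z [1 - φ((x-y) λ^{1/n})] Ψ(2^j x) Ψ(2^k y) ψ(x,y)`. -/
def dampedKernel (n : ℕ) (S : ℝ → ℝ → ℝ) (K : ℝ → ℝ → ℂ) (φ Ψ : ℝ → ℝ) (ψ : ℝ × ℝ → ℂ)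
    (z : ℂ) (lam : ℝ) (j k : ℤ) (x y : ℝ) : ℂ :=
  Complex.exp (Complex.I * ((lam * S x y : ℝ) : ℂ)) * K x y *
    ((|mixedHessian S x y| : ℝ) : ℂ) ^ z *
    ((1 - φ ((x - y) * lam ^ ((1 : ℝ) / n)) : ℝ) : ℂ) *
    ((Ψ ((2 : ℝ) ^ j * x) * Ψ ((2 : ℝ) ^ k * y) : ℝ) : ℂ) * ψ (x, y)

/-- The operator `f ↦ ∑_{(j,k) ∈ J} ∫ k_{j,k}(·, y) f(y) dy`, for kernels `k_{j,k}`. -/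
def sumOperator (J : Set (ℤ × ℤ)) (ker : ℤ → ℤ → ℝ → ℝ → ℂ) (f : ℝ → ℂ) (x : ℝ) : ℂ :=
  ∑' p : J, ∫ y, ker p.1.1 p.1.2 x y * f y

/-- `∑_{(j,k) ∈ J} ∫ k_{j,k}(x, y) f(y) dy` is well defined for all `f ∈ L²(ℝ)` and all `x`, and
defines an operator from `L²(ℝ)` to itself of norm at most `B`. -/
def HasL2Bound (J : Set (ℤ × ℤ)) (ker : ℤ → ℤ → ℝ → ℝ → ℂ) (B : ℝ) : Prop :=
  ∀ f : ℝ → ℂ, MemLp f 2 volume →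
    (∀ p ∈ J, ∀ x, Integrable (fun y => ker p.1 p.2 x y * f y) volume) ∧
    (∀ x, Summable fun p : J => ∫ y, ker p.1.1 p.1.2 x y * f y) ∧
    MemLp (sumOperator J ker f) 2 volume ∧
    eLpNorm (sumOperator J ker f) 2 volume ≤ ENNReal.ofReal B * eLpNorm f 2 volume

/-- The index set `j ≫ k` of `T_Y^z`. -/
def indexY (𝒦 : ℝ) : Set (ℤ × ℤ) := {p | (p.1 : ℝ) > p.2 + 𝒦}

/-- The index set `j ≪ k` of `T_X^z`. -/
def indexX (𝒦 : ℝ) : Set (ℤ × ℤ) := {p | (p.1 : ℝ) < p.2 - 𝒦}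

/-- With the definite factors `Q` of the Hessian given, `‖T_Y^z‖` and `‖T_X^z‖` are at most
`C λ^{μ/n - 1/2}`, with the same `C` for all phases (that is, all `c`, `α`, `m`), all singular
kernels and all `λ > 0`. -/
def DampedL2Estimate (n : ℕ) (μ E 𝒦 : ℝ) (φ Ψ : ℝ → ℝ) (ψ : ℝ × ℝ → ℂ) (z : ℂ)
    {r : ℕ} (Q : Fin r → QuadraticForm ℝ (ℝ × ℝ)) (C : ℝ) : Prop :=
  ∀ (s : ℕ) (α : Fin s → ℝ) (m : Fin s → ℕ) (c : ℝ) (a : ℕ → ℝ),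
    HessianFactors n (phase n a) c α m Q → DominatesLines 𝒦 α →
    ∀ K : ℝ → ℝ → ℂ, IsSingularKernel μ E K → ∀ lam : ℝ, 0 < lam →
      HasL2Bound (indexY 𝒦) (dampedKernel n (phase n a) K φ Ψ ψ z lam)
        (C * lam ^ (μ / n - 1 / 2)) ∧
      HasL2Bound (indexX 𝒦) (dampedKernel n (phase n a) K φ Ψ ψ z lam)
        (C * lam ^ (μ / n - 1 / 2))

end

/-! Since `Ψ` lives on `[1/2, 2]`, only `x, y > 0` matter. In `T_Y`, fix `k` and collect all `j ≫
k`. The resulting piece lives at `y ~ Y = 2^{-k}`, with a bounded factor in `x` (`dyadicTail`) and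
the smooth factor `Ψ(2^k y)`. On its support `x` is much smaller than `y`, so every linear factor of
the Hessian is comparable to `y` and every `Q_l` to `Q_l(0,1) y²`. Hence `S''_{xy}` is comparable to
`h = |c| ∏ Q_l(0,1) Y^{n-2}` and behaves as a symbol in `y`, with constants that depend only on `n`
and on the comparison constant `κ` of the forms (`HessianFactors.symbolAt`,
`HessianFactors.hessianSize_le`).

The `TT*` kernel of one piece is an integral in `y` whose phase `λ(S(x,y) - S(x',y))` has derivative
of size `λ|x-x'|h`. Its amplitude has size `Y^{-2μ} h`, because `Re z = 1/2`. Two integrations by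
parts (`norm_integral_exp_mul_le`) bound the kernel by a constant times `Y^{1-2μ} h / (1 + (λ h Y
|x-x'|)²)`. Integrated over `x - x'` this gives `O(λ⁻¹ Y^{-2μ})`: the factor `h` cancels. That
cancellation is the purpose of the damping, and it makes the estimate uniform in the phase. Schur's
test then bounds the piece by `O(λ^{-1/2} 2^{kμ})` (`exists_schur_majorant`).

The cut-off `1 - φ` keeps `|x-y|` above `λ^{-1/n}/2`, so only `2^k ≤ 4λ^{1/n}` contribute
(`exists_frequency_range`). As `μ > 0`, the norms form a geometric series governed by its top term,
and the triangle inequality gives `λ^{μ/n-1/2}`. No orthogonality between different `k` is needed.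

Exchanging `x` and `y` turns `T_X` into the transpose of an operator of the first kind, so the same
kernel bound is used there through `T*T`. The forms `Q_l` enter the constants only through `κ`, and
`κ = 4` suffices when `𝒦` dominates them. -/

open Filter Topology

/-! ### Symbol calculus for two-jets -/

/-- The two-jet of `f` at `y`, weighted by the powers of `y`, has size at most `M`. The weights
`1, 1, 1/2` make the size submultiplicative. -/
structure SymbolAt (f : ℝ → ℂ) (y M : ℝ) : Prop where
  contDiffAt : ContDiffAt ℝ 2 f y
  bound : ‖f y‖ + y * ‖deriv f y‖ + y ^ 2 / 2 * ‖deriv (deriv f) y‖ ≤ M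

theorem ContDiffAt.eventually_hasDerivAt_of_two {f : ℝ → ℂ} {y : ℝ} (h : ContDiffAt ℝ 2 f y) :
    ∀ᶠ t in 𝓝 y, HasDerivAt f (deriv f t) t := by
  filter_upwards [h.eventually (by simp)] with t ht
  exact (ht.differentiableAt (by simp)).hasDerivAt

theorem ContDiffAt.contDiffAt_deriv_of_two {F : Type*} [NormedAddCommGroup F] [NormedSpace ℝ F]
    {f : ℝ → F} {y : ℝ} (h : ContDiffAt ℝ 2 f y) : ContDiffAt ℝ 1 (deriv f) y := by
  have h1 : ContDiffAt ℝ 1 (fderiv ℝ f) y := h.fderiv_right (by norm_num)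
  exact h1.clm_apply contDiffAt_const

theorem ContDiffAt.hasDerivAt_deriv_of_two {f : ℝ → ℂ} {y : ℝ} (h : ContDiffAt ℝ 2 f y) :
    HasDerivAt (deriv f) (deriv (deriv f) y) y :=
  (h.contDiffAt_deriv_of_two.differentiableAt (by simp)).hasDerivAt

theorem deriv_deriv_eq_of_eventually {f f' : ℝ → ℂ} {f'' : ℂ} {y : ℝ}
    (h1 : ∀ᶠ t in 𝓝 y, HasDerivAt f (f' t) t) (h2 : HasDerivAt f' f'' y) :
    deriv f y = f' y ∧ deriv (deriv f) y = f'' := by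
  have h : deriv f =ᶠ[𝓝 y] f' := h1.mono fun t ht => ht.deriv
  exact ⟨h.eq_of_nhds, h.deriv_eq.trans h2.deriv⟩

namespace SymbolAt

variable {f g : ℝ → ℂ} {y M N : ℝ}

theorem of_hasDerivAt {f' : ℝ → ℂ} {f'' : ℂ} (h0 : ContDiffAt ℝ 2 f y)
    (h1 : ∀ᶠ t in 𝓝 y, HasDerivAt f (f' t) t) (h2 : HasDerivAt f' f'' y)
    (h : ‖f y‖ + y * ‖f' y‖ + y ^ 2 / 2 * ‖f''‖ ≤ M) : SymbolAt f y M := by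
  refine ⟨h0, ?_⟩
  obtain ⟨e1, e2⟩ := deriv_deriv_eq_of_eventually h1 h2
  rwa [e1, e2]

theorem mono (hf : SymbolAt f y M) (h : M ≤ N) : SymbolAt f y N := ⟨hf.1, hf.2.trans h⟩

theorem norm_le (hf : SymbolAt f y M) (hy : 0 ≤ y) : ‖f y‖ ≤ M := by
  have h := hf.2
  have h1 : 0 ≤ y * ‖deriv f y‖ := mul_nonneg hy (norm_nonneg _)
  have h2 : 0 ≤ y ^ 2 / 2 * ‖deriv (deriv f) y‖ := by positivity
  linarith

theorem deriv_le (hf : SymbolAt f y M) : y * ‖deriv f y‖ ≤ M := by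
  have h := hf.2
  have h1 : 0 ≤ ‖f y‖ := by positivity
  have h2 : 0 ≤ y ^ 2 / 2 * ‖deriv (deriv f) y‖ := by positivity
  linarith

theorem deriv_deriv_le (hf : SymbolAt f y M) (hy : 0 ≤ y) :
    y ^ 2 * ‖deriv (deriv f) y‖ ≤ 2 * M := by
  have h := hf.2
  have h1 : 0 ≤ ‖f y‖ := by positivity
  have h2 : 0 ≤ y * ‖deriv f y‖ := by positivity
  linarith

theorem nonneg (hf : SymbolAt f y M) (hy : 0 ≤ y) : 0 ≤ M := (norm_nonneg _).trans (hf.norm_le hy)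

theorem const (c : ℂ) (y : ℝ) : SymbolAt (fun _ => c) y ‖c‖ :=
  of_hasDerivAt (f' := fun _ => 0) (f'' := 0) contDiffAt_const
    (Eventually.of_forall fun t => hasDerivAt_const t c) (hasDerivAt_const y 0) (by simp)

theorem mul (hf : SymbolAt f y M) (hg : SymbolAt g y N) (hy : 0 ≤ y) :
    SymbolAt (fun t => f t * g t) y (M * N) := by
  have hf1 := hf.1.eventually_hasDerivAt_of_two
  have hg1 := hg.1.eventually_hasDerivAt_of_two
  refine of_hasDerivAt (hf.1.mul hg.1) (f' := fun t => deriv f t * g t + f t * deriv g t)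
    (by filter_upwards [hf1, hg1] with t h1 h2 using h1.mul h2)
    ((hf.1.hasDerivAt_deriv_of_two.mul hg1.self_of_nhds).add
      (hf1.self_of_nhds.mul hg.1.hasDerivAt_deriv_of_two)) ?_
  refine le_trans ?_ (mul_le_mul hf.2 hg.2 (by positivity) (hf.nonneg hy))
  generalize f y = a
  generalize deriv f y = b
  generalize deriv (deriv f) y = c
  generalize g y = a'
  generalize deriv g y = b'
  generalize deriv (deriv g) y = c'
  have e1 : ‖b * a' + a * b'‖ ≤ ‖b‖ * ‖a'‖ + ‖a‖ * ‖b'‖ := by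
    simpa using norm_add_le (b * a') (a * b')
  have e2 : ‖c * a' + b * b' + (b * b' + a * c')‖ ≤
      ‖c‖ * ‖a'‖ + 2 * (‖b‖ * ‖b'‖) + ‖a‖ * ‖c'‖ := by
    have h1 := norm_add_le (c * a' + b * b') (b * b' + a * c')
    have h2 := norm_add_le (c * a') (b * b')
    have h3 := norm_add_le (b * b') (a * c')
    simp only [norm_mul] at h1 h2 h3
    linarith
  have e3 := mul_le_mul_of_nonneg_left e1 hy
  have e4 := mul_le_mul_of_nonneg_left e2 (by positivity : 0 ≤ y ^ 2 / 2)
  -- The weights are the Taylor coefficients `1/i!`, so the product of the two sums exceeds the sum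
  -- for `f g` by exactly these terms of order three and four.
  have e5 : 0 ≤ y ^ 3 / 2 * (‖b‖ * ‖c'‖ + ‖c‖ * ‖b'‖) + y ^ 4 / 4 * (‖c‖ * ‖c'‖) := by
    positivity
  rw [norm_mul]
  nlinarith only [e3, e4, e5]

theorem pow (hf : SymbolAt f y M) (hy : 0 ≤ y) (m : ℕ) :
    SymbolAt (fun t => f t ^ m) y (M ^ m) := by
  induction m with
  | zero => simpa using const 1 y
  | succ m ih => simpa only [pow_succ] using ih.mul hf hy

theorem prod {ι : Type*} (s : Finset ι) {f : ι → ℝ → ℂ} {M : ι → ℝ}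
    (hf : ∀ i ∈ s, SymbolAt (f i) y (M i)) (hy : 0 ≤ y) :
    SymbolAt (fun t => ∏ i ∈ s, f i t) y (∏ i ∈ s, M i) := by
  classical
  induction s using Finset.induction_on with
  | empty => simpa using const 1 y
  | insert i s hi ih =>
    simp only [Finset.prod_insert hi]
    exact (hf i (by simp)).mul (ih fun j hj => hf j (by simp [hj])) hy

theorem conj (hf : SymbolAt f y M) :
    SymbolAt (fun t => (starRingEnd ℂ) (f t)) y M := by
  have h2 : HasDerivAt (fun t => (starRingEnd ℂ) (deriv f t))
      ((starRingEnd ℂ) (deriv (deriv f) y)) y :=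
    hf.1.hasDerivAt_deriv_of_two.star
  refine of_hasDerivAt (f' := fun t => (starRingEnd ℂ) (deriv f t))
    (Complex.conjCLE.contDiff.contDiffAt.comp y hf.1)
    (hf.1.eventually_hasDerivAt_of_two.mono fun t ht => ht.star) h2 ?_
  simpa only [RCLike.norm_conj] using hf.2

/-- The jet of `1/f` contributes `1/m`, `M/m²`, `M/m²` and `M²/m³`; as `m ≤ M`, each is at most
`M²/m³`, which explains the factor `4`. -/
theorem inv {m : ℝ} (hf : SymbolAt f y M) (hy : 0 ≤ y) (hm : 0 < m) (h : m ≤ ‖f y‖) :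
    SymbolAt (fun t => (f t)⁻¹) y (4 * M ^ 2 / m ^ 3) := by
  have h0 : f y ≠ 0 := norm_pos_iff.1 (hm.trans_le h)
  have hf1 := hf.1.eventually_hasDerivAt_of_two
  have hne : ∀ᶠ t in 𝓝 y, f t ≠ 0 := hf.1.continuousAt.eventually_ne h0
  refine of_hasDerivAt (hf.1.inv h0) (f' := fun t => -deriv f t / f t ^ 2)
    (by filter_upwards [hf1, hne] with t h1 h2 using h1.inv h2)
    (hf.1.hasDerivAt_deriv_of_two.neg.div (hf1.self_of_nhds.pow 2) (pow_ne_zero 2 h0)) ?_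
  have hM := hf.nonneg hy
  have hmM : m ≤ M := h.trans (hf.norm_le hy)
  have b1 := hf.deriv_le
  have b2 := hf.deriv_deriv_le hy
  set a := f y
  set b := deriv f y
  set c := deriv (deriv f) y
  have ha : 0 < ‖a‖ := norm_pos_iff.2 h0
  have e0 : ‖a⁻¹‖ ≤ 1 / m := by
    rw [norm_inv, ← one_div]; gcongr
  have e1 : y * ‖-b / a ^ 2‖ ≤ M / m ^ 2 := by
    rw [norm_div, norm_neg, norm_pow, ← mul_div_assoc]; gcongr
  have e2 : y ^ 2 / 2 * ‖(-c * a ^ 2 - -b * (((2 : ℕ) : ℂ) * a ^ (2 - 1) * b)) / (a ^ 2) ^ 2‖ ≤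
      M / m ^ 2 + M ^ 2 / m ^ 3 := by
    have : (-c * a ^ 2 - -b * (((2 : ℕ) : ℂ) * a ^ (2 - 1) * b)) / (a ^ 2) ^ 2 =
      -c / a ^ 2 + 2 * b ^ 2 / a ^ 3 := by
      field_simp
      push_cast
      ring
    rw [this]
    have t1 : y ^ 2 / 2 * ‖-c / a ^ 2‖ ≤ M / m ^ 2 := by
      rw [norm_div, norm_neg, norm_pow, ← mul_div_assoc]; gcongr; linarith
    have t2 : y ^ 2 / 2 * ‖2 * b ^ 2 / a ^ 3‖ ≤ M ^ 2 / m ^ 3 := by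
      rw [norm_div, norm_mul, norm_pow, norm_pow, ← mul_div_assoc];
      have : y ^ 2 / 2 * (‖(2:ℂ)‖ * ‖b‖ ^ 2) = (y * ‖b‖) ^ 2 := by
        rw [Complex.norm_ofNat]; ring
      rw [this]; gcongr
    have := mul_le_mul_of_nonneg_left (norm_add_le (-c / a ^ 2) (2 * b ^ 2 / a ^ 3))
      (by positivity : 0 ≤ y ^ 2 / 2)
    linarith
  have s1 : 1 / m ≤ M ^ 2 / m ^ 3 := by
    rw [div_le_div_iff₀ hm (by positivity)]
    nlinarith [mul_le_mul hmM hmM hm.le hM]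
  have s2 : M / m ^ 2 ≤ M ^ 2 / m ^ 3 := by
    rw [div_le_div_iff₀ (by positivity) (by positivity)]
    nlinarith [mul_le_mul_of_nonneg_left hmM (by positivity : 0 ≤ M * m ^ 2)]
  have : 4 * M ^ 2 / m ^ 3 = M ^ 2 / m ^ 3 + M ^ 2 / m ^ 3 + (M ^ 2 / m ^ 3 + M ^ 2 / m ^ 3) := by
    ring
  rw [this]
  simp only [Pi.pow_apply, Pi.neg_apply] at *
  linarith

/-- Precomposition with an affine map. -/
theorem comp_affine {θ : ℝ → ℂ} (hθ : ContDiff ℝ 2 θ) (a b : ℝ)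
    (h : ‖θ (a * y + b)‖ + y * (|a| * ‖deriv θ (a * y + b)‖) +
      y ^ 2 / 2 * (a ^ 2 * ‖deriv (deriv θ) (a * y + b)‖) ≤ M) :
    SymbolAt (fun t => θ (a * t + b)) y M := by
  have ha : ∀ t, HasDerivAt (fun t : ℝ => a * t + b) a t := fun t => by
    simpa using ((hasDerivAt_id t).const_mul a).add_const b
  have h1 : ∀ t, HasDerivAt θ (deriv θ t) t := fun t =>
    (hθ.differentiable (by simp) t).hasDerivAt
  have h2 : ∀ t, HasDerivAt (deriv θ) (deriv (deriv θ) t) t := fun t =>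
    hθ.contDiffAt.hasDerivAt_deriv_of_two
  refine of_hasDerivAt (f' := fun t => a • deriv θ (a * t + b))
    (f'' := a • a • deriv (deriv θ) (a * y + b)) (by fun_prop)
    (Eventually.of_forall fun t => (h1 _).scomp t (ha t))
    (((h2 _).scomp y (ha y)).const_smul a) ?_
  simp only [norm_smul, Real.norm_eq_abs, ← mul_assoc, abs_mul_abs_self] at *
  rw [pow_two a] at h
  simpa only [mul_assoc] using h

/-- Complex powers of a real symbol that is bounded below. -/
theorem abs_cpow {H : ℝ → ℝ} {m : ℝ} {z : ℂ} (hH : SymbolAt (fun t => (H t : ℂ)) y M)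
    (hHd : ContDiffAt ℝ 2 H y) (hy : 0 ≤ y) (hm : 0 < m) (h : m ≤ |H y|) (hz : z.re = 1 / 2) :
    SymbolAt (fun t => ((|H t| : ℝ) : ℂ) ^ z) y (√M * (4 * (1 + ‖z‖) ^ 2 * (M / m) ^ 2)) := by
  have h0 : H y ≠ 0 := by
    intro h1; rw [h1, abs_zero] at h; linarith
  have hne : ∀ᶠ t in 𝓝 y, H t ≠ 0 := hHd.continuousAt.eventually_ne h0
  set u : ℝ → ℝ := fun t => deriv H t / H t with hu
  have hH1 : ∀ᶠ t in 𝓝 y, HasDerivAt H (deriv H t) t := by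
    filter_upwards [hHd.eventually (by simp)] with t ht
    exact (ht.differentiableAt (by simp)).hasDerivAt
  have hH2 : HasDerivAt (deriv H) (deriv (deriv H) y) y := by
    exact (hHd.contDiffAt_deriv_of_two.differentiableAt (by simp)).hasDerivAt
  -- `Real.log` is even, so one formula covers both signs of `H`, and the logarithmic derivative
  -- `H'/H` needs no case distinction.
  have hform : ∀ t, H t ≠ 0 → ((|H t| : ℝ) : ℂ) ^ z = Complex.exp (((Real.log (H t) : ℝ) : ℂ) * z) := by
    intro t ht
    rw [Complex.cpow_def_of_ne_zero (by simpa using ht), ← Complex.ofReal_log (abs_nonneg _),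
      Real.log_abs]
  set F : ℝ → ℂ := fun t => ((|H t| : ℝ) : ℂ) ^ z with hF
  have hFeq : F =ᶠ[𝓝 y] fun t => Complex.exp (((Real.log (H t) : ℝ) : ℂ) * z) :=
    hne.mono fun t ht => hform t ht
  have hcd : ContDiffAt ℝ 2 F y := by
    refine ContDiffAt.congr_of_eventuallyEq ?_ hFeq
    exact (((Complex.ofRealCLM.contDiff.contDiffAt.comp y (hHd.log h0)).mul contDiffAt_const)).cexp
  have hlog : ∀ᶠ t in 𝓝 y, HasDerivAt (fun t => ((Real.log (H t) : ℝ) : ℂ)) (u t : ℂ) t := by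
    filter_upwards [hH1, hne] with t h1 h2 using (h1.log h2).ofReal_comp
  have hF1 : ∀ᶠ t in 𝓝 y, HasDerivAt F (F t * ((u t : ℂ) * z)) t := by
    filter_upwards [hlog, hne, hFeq.eventually_nhds] with t h1 h2 h3
    refine HasDerivAt.congr_of_eventuallyEq ?_ h3
    have := (h1.mul_const z).cexp
    rwa [← hform t h2] at this
  have hu1 : HasDerivAt u ((deriv (deriv H) y * H y - deriv H y * deriv H y) / H y ^ 2) y :=
    hH2.div hH1.self_of_nhds h0
  refine of_hasDerivAt hcd hF1 (hF1.self_of_nhds.mul (hu1.ofReal_comp.mul_const z)) ?_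
  have hM := hH.nonneg hy
  have hmM : m ≤ M := h.trans (by simpa using hH.norm_le hy)
  have hd := deriv_deriv_eq_of_eventually (hH1.mono fun t ht => ht.ofReal_comp) hH2.ofReal_comp
  have b0 := hH.norm_le hy
  have b1 := hH.deriv_le
  have b2 := hH.deriv_deriv_le hy
  rw [hd.1] at b1
  rw [hd.2] at b2
  simp only [Complex.norm_real, Real.norm_eq_abs] at b0 b1 b2
  have hR : 1 ≤ M / m := (one_le_div hm).2 hmM
  have hFn : ‖F y‖ ≤ √M := by
    rw [hF]
    simp only
    rw [Complex.norm_cpow_eq_rpow_re_of_pos (by positivity), hz, ← Real.sqrt_eq_rpow]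
    exact Real.sqrt_le_sqrt b0
  have hHy : 0 < |H y| := by positivity
  have c1 : y * |u y| ≤ M / m := by
    rw [hu]
    simp only
    rw [abs_div, ← mul_div_assoc]
    gcongr
  have c2 : y ^ 2 * |(deriv (deriv H) y * H y - deriv H y * deriv H y) / H y ^ 2| ≤
      2 * (M / m) + (M / m) ^ 2 := by
    have e : (deriv (deriv H) y * H y - deriv H y * deriv H y) / H y ^ 2 =
      deriv (deriv H) y / H y - u y ^ 2 := by
      rw [hu]; field_simp
    rw [e]
    have e1 := abs_sub (deriv (deriv H) y / H y) (u y ^ 2)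
    rw [abs_div, abs_pow] at e1
    have e2 : y ^ 2 * (|deriv (deriv H) y| / |H y|) ≤ 2 * (M / m) := by
      rw [← mul_div_assoc, ← mul_div_assoc]; gcongr
    have e3 : y ^ 2 * |u y| ^ 2 ≤ (M / m) ^ 2 := by
      rw [← mul_pow]; gcongr
    nlinarith [mul_le_mul_of_nonneg_left e1 (sq_nonneg y)]
  set v := (deriv (deriv H) y * H y - deriv H y * deriv H y) / H y ^ 2
  set R := M / m
  set Z := ‖z‖
  have hZ : 0 ≤ Z := norm_nonneg z
  have n1 : y * ‖F y * ((u y : ℂ) * z)‖ ≤ √M * (R * Z) := by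
    rw [norm_mul, norm_mul, Complex.norm_real, Real.norm_eq_abs]
    calc y * (‖F y‖ * (|u y| * Z)) = ‖F y‖ * ((y * |u y|) * Z) := by ring
      _ ≤ _ := by gcongr
  have n2 : y ^ 2 / 2 * ‖F y * ((u y : ℂ) * z) * ((u y : ℂ) * z) + F y * ((v : ℂ) * z)‖ ≤
      √M * ((R * Z) ^ 2 / 2 + (2 * R + R ^ 2) * Z / 2) := by
    have e1 := norm_add_le (F y * ((u y : ℂ) * z) * ((u y : ℂ) * z)) (F y * ((v : ℂ) * z))
    simp only [norm_mul, Complex.norm_real, Real.norm_eq_abs] at e1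
    calc _ ≤ y ^ 2 / 2 * (‖F y‖ * (|u y| * Z) * (|u y| * Z) + ‖F y‖ * (|v| * Z)) := by gcongr
      _ = ‖F y‖ * (((y * |u y|) * Z) ^ 2 / 2 + (y ^ 2 * |v|) * Z / 2) := by ring
      _ ≤ _ := by gcongr
  have hR0 : 0 ≤ R := by linarith
  -- Since `R = M / m ≥ 1`, all lower powers of `R` are absorbed in `R²`.
  have fin : 1 + R * Z + ((R * Z) ^ 2 / 2 + (2 * R + R ^ 2) * Z / 2) ≤ 4 * (1 + Z) ^ 2 * R ^ 2 := by
    have r2 : R ≤ R ^ 2 := by nlinarith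
    have r3 : 1 ≤ R ^ 2 := by nlinarith
    have r4 : R * Z ≤ R ^ 2 * Z := by gcongr
    have r5 : 0 ≤ R ^ 2 * Z := by positivity
    have r6 : 0 ≤ R ^ 2 * Z ^ 2 := by positivity
    nlinarith
  have := mul_le_mul_of_nonneg_left fin (Real.sqrt_nonneg M)
  nlinarith

end SymbolAt

/-! ### Nonstationary phase -/

/-- Two integrations by parts in an oscillatory integral whose phase has derivative `p`. -/
theorem integral_exp_mul_eq {g p : ℝ → ℝ} {a : ℝ → ℂ} {s t : ℝ} (hst : s ≤ t)
    (hg : ∀ y, HasDerivAt g (p y) y) (hp : ∀ y ∈ Set.Icc s t, ContDiffAt ℝ 2 p y)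
    (hp0 : ∀ y ∈ Set.Icc s t, p y ≠ 0) (ha : ∀ y ∈ Set.Icc s t, ContDiffAt ℝ 2 a y)
    (has : a s = 0) (hat : a t = 0) (has' : deriv a s = 0) (hat' : deriv a t = 0) :
    ∫ y in s..t, Complex.exp (Complex.I * (g y : ℂ)) * a y =
      -∫ y in s..t, Complex.exp (Complex.I * (g y : ℂ)) *
        (deriv (deriv fun y => a y * (p y : ℂ)⁻¹) y * (p y : ℂ)⁻¹ +
          deriv (fun y => a y * (p y : ℂ)⁻¹) y * deriv (fun y => (p y : ℂ)⁻¹) y) := by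
  set u : ℝ → ℂ := fun y => (p y : ℂ)⁻¹ with hu
  set w : ℝ → ℂ := fun y => a y * u y with hw
  set e : ℝ → ℂ := fun y => Complex.exp (Complex.I * (g y : ℂ)) with he
  have hu2 : ∀ y ∈ Set.Icc s t, ContDiffAt ℝ 2 u y := fun y hy =>
    (Complex.ofRealCLM.contDiff.contDiffAt.comp y (hp y hy)).inv
      (by simpa using hp0 y hy)
  have hw2 : ∀ y ∈ Set.Icc s t, ContDiffAt ℝ 2 w y := fun y hy => (ha y hy).mul (hu2 y hy)
  have hec : Continuous e := by
    have : Continuous g := continuous_iff_continuousAt.2 fun y => (hg y).continuousAt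
    fun_prop
  have hed : ∀ y, HasDerivAt e (e y * (Complex.I * (p y : ℂ))) y := fun y =>
    ((hg y).ofReal_comp.const_mul Complex.I).cexp
  have hw1 : ∀ y ∈ Set.Icc s t, HasDerivAt w (deriv w y) y := fun y hy =>
    (hw2 y hy).eventually_hasDerivAt_of_two.self_of_nhds
  have hu1 : ∀ y ∈ Set.Icc s t, HasDerivAt u (deriv u y) y := fun y hy =>
    (hu2 y hy).eventually_hasDerivAt_of_two.self_of_nhds
  -- Both integrations by parts are carried by the single primitive `-i e w + e w' u`, where `u =
  -- 1/p` and `w = a/p`. The terms in `e w'` cancel because `p u = 1`, and the primitive vanishes at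
  -- both ends together with `w` and `w'`.
  have hd : ∀ y ∈ Set.Icc s t, HasDerivAt (fun y => -Complex.I * e y * w y + e y * (deriv w y * u y))
      (e y * a y + e y * (deriv (deriv w) y * u y + deriv w y * deriv u y)) y := by
    intro y hy
    have h := (((hed y).const_mul (-Complex.I)).mul (hw1 y hy)).add
      ((hed y).mul ((hw2 y hy).hasDerivAt_deriv_of_two.mul (hu1 y hy)))
    refine h.congr_deriv ?_
    have hpu : (p y : ℂ) * u y = 1 := mul_inv_cancel₀ (by simpa using hp0 y hy)
    have hpw : (p y : ℂ) * w y = a y := by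
      rw [hw]; simp only; rw [mul_left_comm, hpu, mul_one]
    rw [Pi.mul_apply]
    linear_combination e y * hpw + Complex.I * e y * (deriv w y) * hpu
      - e y * (p y : ℂ) * w y * Complex.I_sq
  have hac : ContinuousOn a (Set.Icc s t) := fun y hy => (ha y hy).continuousAt.continuousWithinAt
  have hc : ContinuousOn (fun y => deriv (deriv w) y * u y + deriv w y * deriv u y)
      (Set.Icc s t) := by
    intro y hy
    have h1 : ContinuousAt (deriv (deriv w)) y := by
      have : ContDiffAt ℝ 0 (deriv (deriv w)) y :=
        (hw2 y hy).contDiffAt_deriv_of_two.derivWithin (by norm_num)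
      exact this.continuousAt
    exact ((h1.mul (hu2 y hy).continuousAt).add
      ((hw2 y hy).contDiffAt_deriv_of_two.continuousAt.mul
        (hu2 y hy).contDiffAt_deriv_of_two.continuousAt)).continuousWithinAt
  have i1 : IntervalIntegrable (fun y => e y * a y) volume s t :=
    (hec.continuousOn.mul hac).intervalIntegrable_of_Icc hst
  have i2 : IntervalIntegrable (fun y => e y * (deriv (deriv w) y * u y + deriv w y * deriv u y))
      volume s t := (hec.continuousOn.mul hc).intervalIntegrable_of_Icc hst
  have hend : ∀ y ∈ Set.Icc s t, a y = 0 → deriv a y = 0 → w y = 0 ∧ deriv w y = 0 := by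
    intro y hy h0 h1
    have := ((ha y hy).eventually_hasDerivAt_of_two.self_of_nhds.mul (hu1 y hy)).deriv
    refine ⟨by simp [hw, h0], ?_⟩
    rw [h0, h1, zero_mul, zero_mul, add_zero] at this
    exact this
  have hs := hend s ⟨le_rfl, hst⟩ has has'
  have ht := hend t ⟨hst, le_rfl⟩ hat hat'
  have key := intervalIntegral.integral_eq_sub_of_hasDerivAt
    (fun y hy => hd y (by rwa [Set.uIcc_of_le hst] at hy)) (i1.add i2)
  rw [intervalIntegral.integral_add i1 i2, hs.1, hs.2, ht.1, ht.2] at key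
  exact eq_neg_of_add_eq_zero_left (by simpa using key)

/-- An oscillatory integral over the dyadic interval `[Y/2, 2Y]` decays quadratically in the size
`m` of the derivative of the phase. -/
theorem norm_integral_exp_mul_le {g p : ℝ → ℝ} {a : ℝ → ℂ} {Y A m R : ℝ} (hY : 0 < Y) (hm : 0 ≤ m)
    (hR : 1 ≤ R) (hg : ∀ y, HasDerivAt g (p y) y)
    (hpc : ContDiff ℝ 2 p)
    (hp : ∀ y ∈ Set.Icc (Y / 2) (2 * Y), SymbolAt (fun y => (p y : ℂ)) y (R * m))
    (hpm : ∀ y ∈ Set.Icc (Y / 2) (2 * Y), m ≤ |p y|)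
    (ha : ∀ y ∈ Set.Icc (Y / 2) (2 * Y), SymbolAt a y A)
    (hsupp : ∀ y, y ∉ Set.Icc (Y / 2) (2 * Y) → a y = 0)
    (has : a (Y / 2) = 0) (hat : a (2 * Y) = 0)
    (has' : deriv a (Y / 2) = 0) (hat' : deriv a (2 * Y) = 0) :
    ‖∫ y, Complex.exp (Complex.I * (g y : ℂ)) * a y‖ ≤ 600 * A * R ^ 4 * Y / (1 + (m * Y) ^ 2) := by
  have hle : Y / 2 ≤ 2 * Y := by linarith
  have hpos : ∀ y ∈ Set.Icc (Y / 2) (2 * Y), 0 < y := fun y hy => by linarith [hy.1]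
  have hA : 0 ≤ A := (ha (Y / 2) ⟨le_rfl, hle⟩).nonneg (by linarith)
  have hR4 : 1 ≤ R ^ 4 := one_le_pow₀ hR
  have hint : ∫ y, Complex.exp (Complex.I * (g y : ℂ)) * a y =
      ∫ y in (Y / 2)..(2 * Y), Complex.exp (Complex.I * (g y : ℂ)) * a y := by
    rw [intervalIntegral.integral_of_le hle, ← integral_Icc_eq_integral_Ioc,
      setIntegral_eq_integral_of_forall_compl_eq_zero]
    intro y hy
    rw [hsupp y hy, mul_zero]
  have hexp : ∀ y, ‖Complex.exp (Complex.I * (g y : ℂ))‖ = 1 := fun y => by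
    rw [mul_comm]; exact Complex.norm_exp_ofReal_mul_I _
  have hlen : |2 * Y - Y / 2| = 3 / 2 * Y := by
    rw [abs_of_nonneg (by linarith)]; ring
  rw [hint]
  -- For `m Y ≤ 1` the length of the interval already suffices; the integrations by parts are needed
  -- only beyond.
  rcases le_or_gt (m * Y) 1 with h1 | h1
  · have h := intervalIntegral.norm_integral_le_of_norm_le_const (a := Y / 2) (b := 2 * Y) (C := A)
      (f := fun y => Complex.exp (Complex.I * (g y : ℂ)) * a y) (fun y hy => by
        rw [Set.uIoc_of_le hle] at hy
        have hy' : y ∈ Set.Icc (Y / 2) (2 * Y) := ⟨hy.1.le, hy.2⟩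
        rw [norm_mul, hexp, one_mul]
        exact (ha y hy').norm_le (hpos y hy').le)
    rw [hlen] at h
    refine h.trans ?_
    rw [le_div_iff₀ (by positivity)]
    have h2 : (m * Y) ^ 2 ≤ 1 := pow_le_one₀ (by positivity) h1
    calc A * (3 / 2 * Y) * (1 + (m * Y) ^ 2) ≤ A * (3 / 2 * Y) * (1 + 1) := by gcongr
      _ = 3 * A * 1 * Y := by ring
      _ ≤ 600 * A * R ^ 4 * Y := by gcongr; norm_num
  · have hm0 : 0 < m := by
      rcases hm.lt_or_eq with h | h
      · exact h
      · rw [← h, zero_mul] at h1; linarith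
    have hpne : ∀ y ∈ Set.Icc (Y / 2) (2 * Y), p y ≠ 0 := fun y hy h => by
      have := hpm y hy; rw [h, abs_zero] at this; linarith
    rw [integral_exp_mul_eq hle hg (fun y _ => hpc.contDiffAt) hpne (fun y hy => (ha y hy).1)
      has hat has' hat', norm_neg]
    -- The symbol bounds give `32 + 16 = 48` with weight `y²`, and `y ≥ Y/2` turns this into `192`.
    -- The length `3Y/2` and `1 + (mY)² ≤ 2(mY)²` lead to `576 ≤ 600`.
    have h := intervalIntegral.norm_integral_le_of_norm_le_const (a := Y / 2) (b := 2 * Y)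
      (C := 192 * A * R ^ 4 / (m * Y) ^ 2)
      (f := fun y => Complex.exp (Complex.I * (g y : ℂ)) *
        (deriv (deriv fun y => a y * (p y : ℂ)⁻¹) y * (p y : ℂ)⁻¹ +
          deriv (fun y => a y * (p y : ℂ)⁻¹) y * deriv (fun y => (p y : ℂ)⁻¹) y)) (fun y hy => by
        rw [Set.uIoc_of_le hle] at hy
        have hy' : y ∈ Set.Icc (Y / 2) (2 * Y) := ⟨hy.1.le, hy.2⟩
        have hy0 := hpos y hy'
        rw [norm_mul, hexp, one_mul]
        have hu := (hp y hy').inv hy0.le hm0 (by simpa using hpm y hy')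
        have hU : 4 * (R * m) ^ 2 / m ^ 3 = 4 * R ^ 2 / m := by field_simp
        rw [hU] at hu
        have hw := (ha y hy').mul hu hy0.le
        set u : ℝ → ℂ := fun y => (p y : ℂ)⁻¹
        set w : ℝ → ℂ := fun y => a y * u y
        have b1 := hu.norm_le hy0.le
        have b2 := hu.deriv_le
        have b3 := hw.deriv_le
        have b4 := hw.deriv_deriv_le hy0.le
        have e1 := norm_add_le (deriv (deriv w) y * u y) (deriv w y * deriv u y)
        rw [norm_mul, norm_mul] at e1
        refine e1.trans ?_
        have e2 : y ^ 2 * (‖deriv (deriv w) y‖ * ‖u y‖ + ‖deriv w y‖ * ‖deriv u y‖) ≤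
            48 * A * R ^ 4 / m ^ 2 := by
          calc _ = (y ^ 2 * ‖deriv (deriv w) y‖) * ‖u y‖ +
              (y * ‖deriv w y‖) * (y * ‖deriv u y‖) := by ring
            _ ≤ (2 * (A * (4 * R ^ 2 / m))) * (4 * R ^ 2 / m) +
              (A * (4 * R ^ 2 / m)) * (4 * R ^ 2 / m) := by gcongr
            _ = _ := by field_simp; ring
        have e3 : (Y / 2) ^ 2 ≤ y ^ 2 := by gcongr; exact hy'.1
        have e4 := (mul_le_mul_of_nonneg_right e3 (by positivity : 0 ≤
          ‖deriv (deriv w) y‖ * ‖u y‖ + ‖deriv w y‖ * ‖deriv u y‖)).trans e2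
        rw [← le_div_iff₀' (by positivity)] at e4
        refine e4.trans (le_of_eq ?_)
        field_simp
        ring)
    rw [hlen] at h
    refine h.trans ?_
    rw [le_div_iff₀ (by positivity), div_mul_eq_mul_div, div_mul_eq_mul_div,
      div_le_iff₀ (by positivity)]
    have h2 : 1 ≤ (m * Y) ^ 2 := one_le_pow₀ h1.le
    have : 0 ≤ A * R ^ 4 * Y := by positivity
    nlinarith

/-! ### Schur's test in `T*T` and `TT*` form -/

/-- A bounded measurable kernel supported in the square `[-R, R]²`. -/
structure IsBoxKernel (κ : ℝ × ℝ → ℂ) (M R : ℝ) : Prop where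
  measurable : Measurable κ
  bound : ∀ p, ‖κ p‖ ≤ M
  supp : ∀ x y, κ (x, y) ≠ 0 → x ∈ Set.Icc (-R) R ∧ y ∈ Set.Icc (-R) R

namespace IsBoxKernel

variable {κ : ℝ × ℝ → ℂ} {M R : ℝ}

theorem transpose_conj (h : IsBoxKernel κ M R) :
    IsBoxKernel (fun p => (starRingEnd ℂ) (κ (p.2, p.1))) M R where
  measurable := by
    have : Measurable fun p : ℝ × ℝ => κ (p.2, p.1) := h.measurable.comp measurable_swap
    exact Complex.continuous_conj.measurable.comp this
  bound p := by rw [RCLike.norm_conj]; exact h.bound _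
  supp x y hxy := (h.supp y x fun h0 => hxy (by simp [h0])).symm

theorem nonneg (h : IsBoxKernel κ M R) : 0 ≤ M := (norm_nonneg _).trans (h.bound 0)

theorem integrableOn {f : ℝ → ℂ} (hf : MemLp f 2 volume) (R : ℝ) :
    IntegrableOn f (Set.Icc (-R) R) := by
  have h : MemLp f 2 (volume.restrict (Set.Icc (-R) R)) := hf.restrict _
  exact h.integrable one_le_two

theorem norm_mul_le (h : IsBoxKernel κ M R) (f : ℝ → ℂ) (x y : ℝ) :
    ‖κ (x, y) * f y‖ ≤ M * (Set.Icc (-R) R).indicator (fun y => ‖f y‖) y := by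
  by_cases h0 : κ (x, y) = 0
  · rw [h0, zero_mul, norm_zero]
    exact mul_nonneg h.nonneg (Set.indicator_nonneg (fun _ _ => norm_nonneg _) _)
  · have hy := (h.supp x y h0).2
    rw [Set.indicator_of_mem hy, norm_mul]
    gcongr
    exact h.bound _

theorem aestronglyMeasurable_slice (h : IsBoxKernel κ M R) (x : ℝ) :
    AEStronglyMeasurable (fun y => κ (x, y)) volume :=
  (h.measurable.comp measurable_prodMk_left).aestronglyMeasurable

theorem integrable_indicator {f : ℝ → ℂ} (hf : MemLp f 2 volume) (R : ℝ) :
    Integrable ((Set.Icc (-R) R).indicator fun y => ‖f y‖) volume :=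
  (integrable_indicator_iff measurableSet_Icc).2 (integrableOn hf R).norm

theorem integrable_mul (h : IsBoxKernel κ M R) {f : ℝ → ℂ} (hf : MemLp f 2 volume) (x : ℝ) :
    Integrable (fun y => κ (x, y) * f y) volume :=
  ((integrable_indicator hf R).const_mul M).mono'
    ((h.aestronglyMeasurable_slice x).mul hf.1) (Eventually.of_forall (h.norm_mul_le f x))

theorem memLp (h : IsBoxKernel κ M R) {f : ℝ → ℂ} (hf : MemLp f 2 volume) :
    MemLp (fun x => ∫ y, κ (x, y) * f y) 2 volume := by
  have hmeas : AEStronglyMeasurable (fun x => ∫ y, κ (x, y) * f y) volume := by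
    have : AEStronglyMeasurable (fun p : ℝ × ℝ => κ p * f p.2) (volume.prod volume) :=
      h.measurable.aestronglyMeasurable.mul hf.1.comp_snd
    exact this.integral_prod_right'
  set I := ∫ y, M * (Set.Icc (-R) R).indicator (fun y => ‖f y‖) y
  have hb : ∀ x, ‖∫ y, κ (x, y) * f y‖ ≤ ‖(Set.Icc (-R) R).indicator (fun _ => I) x‖ := by
    intro x
    by_cases hx : x ∈ Set.Icc (-R) R
    · rw [Set.indicator_of_mem hx]
      exact (norm_integral_le_of_norm_le ((integrable_indicator hf R).const_mul M)
        (Eventually.of_forall (h.norm_mul_le f x))).trans (le_abs_self _)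
    · have : ∀ y, κ (x, y) = 0 := fun y => by
        by_contra h0
        exact hx (h.supp x y h0).1
      simp [this]
  exact (memLp_indicator_const 2 measurableSet_Icc I (Or.inr (by simp))).mono hmeas
    (Eventually.of_forall hb)

/-- Expand the square and integrate in `x` first. What remains is `∬ w(y-y') |f(y)| |f(y')|`, and
`2|f(y)||f(y')| ≤ |f(y)|² + |f(y')|²` reduces it to two convolutions with `w`. Fubini is legitimate
because an `L²` function is integrable on the box. -/
theorem integral_norm_sq_le (h : IsBoxKernel κ M R) {w : ℝ → ℝ} (hw : Integrable w)
    (hwe : ∀ t, w (-t) = w t)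
    (hκ : ∀ y y', ‖∫ x, κ (x, y) * (starRingEnd ℂ) (κ (x, y'))‖ ≤ w (y - y'))
    {f : ℝ → ℂ} (hf : MemLp f 2 volume) :
    ∫ x, ‖∫ y, κ (x, y) * f y‖ ^ 2 ≤ (∫ t, w t) * ∫ y, ‖f y‖ ^ 2 := by
  set F : ℝ → ℂ := fun x => ∫ y, κ (x, y) * f y with hF
  set G : ℝ × ℝ × ℝ → ℂ := fun p =>
    (κ (p.1, p.2.1) * f p.2.1) * (starRingEnd ℂ) (κ (p.1, p.2.2) * f p.2.2) with hG
  have hf2 : Integrable (fun y => ‖f y‖ ^ 2) volume := (memLp_two_iff_integrable_sq_norm hf.1).1 hf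
  have hM := h.nonneg
  have hGint : Integrable G (volume.prod (volume.prod volume)) := by
    have hi := integrable_indicator hf R
    have h1 : Integrable ((Set.Icc (-R) R).indicator fun _ : ℝ => (1 : ℝ)) volume :=
      (integrable_indicator_iff measurableSet_Icc).2 (by simp)
    refine ((h1.mul_prod (hi.mul_prod hi)).const_mul (M ^ 2)).mono' ?_ (Eventually.of_forall ?_)
    · have m1 : Measurable fun p : ℝ × ℝ × ℝ => κ (p.1, p.2.1) :=
        h.measurable.comp (by fun_prop)
      have m2 : Measurable fun p : ℝ × ℝ × ℝ => κ (p.1, p.2.2) :=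
        h.measurable.comp (by fun_prop)
      have f1 : AEStronglyMeasurable (fun p : ℝ × ℝ × ℝ => f p.2.1)
          (volume.prod (volume.prod volume)) := (hf.1.comp_fst (ν := volume)).comp_snd
      have f2 : AEStronglyMeasurable (fun p : ℝ × ℝ × ℝ => f p.2.2)
          (volume.prod (volume.prod volume)) := (hf.1.comp_snd (μ := volume)).comp_snd
      exact (m1.aestronglyMeasurable.mul f1).mul
        (Complex.continuous_conj.comp_aestronglyMeasurable (m2.aestronglyMeasurable.mul f2))
    · rintro ⟨x, y, y'⟩
      by_cases hx : x ∈ Set.Icc (-R) R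
      · simp only [hG, Set.indicator_of_mem hx, one_mul]
        rw [norm_mul, RCLike.norm_conj]
        refine (mul_le_mul (h.norm_mul_le f x y) (h.norm_mul_le f x y') (norm_nonneg _)
          (mul_nonneg hM (Set.indicator_nonneg (fun _ _ => norm_nonneg _) _))).trans (le_of_eq ?_)
        ring
      · have : κ (x, y) = 0 := by
          by_contra h0
          exact hx (h.supp x y h0).1
        simp [hG, this, Set.indicator_of_notMem hx]
  have e1 : ((∫ x, ‖F x‖ ^ 2 : ℝ) : ℂ) = ∫ x, ∫ q : ℝ × ℝ, G (x, q) := by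
    rw [← integral_complex_ofReal]
    refine integral_congr_ae (Eventually.of_forall fun x => ?_)
    simp only [hG]
    rw [show (volume : Measure (ℝ × ℝ)) = volume.prod volume from rfl,
      integral_prod_mul (fun y => κ (x, y) * f y) fun y => (starRingEnd ℂ) (κ (x, y) * f y),
      integral_conj, Complex.mul_conj, Complex.normSq_eq_norm_sq]
  have e2 : ∫ x, ∫ q : ℝ × ℝ, G (x, q) = ∫ q : ℝ × ℝ, ∫ x, G (x, q) :=
    integral_integral_swap hGint
  have b1 : ∀ q : ℝ × ℝ, ‖∫ x, G (x, q)‖ ≤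
      1 / 2 * (‖f q.2‖ ^ 2 * w (q.1 - q.2) + ‖f q.1‖ ^ 2 * w (q.1 - q.2)) := by
    rintro ⟨y, y'⟩
    have : ∀ x, G (x, y, y') = (κ (x, y) * (starRingEnd ℂ) (κ (x, y'))) *
        (f y * (starRingEnd ℂ) (f y')) := fun x => by
      simp only [hG, map_mul]; ring
    simp only [this]
    rw [integral_mul_const, norm_mul, norm_mul, RCLike.norm_conj]
    have hb := hκ y y'
    have hw0 := (norm_nonneg _).trans hb
    have : ‖f y‖ * ‖f y'‖ ≤ 1 / 2 * (‖f y'‖ ^ 2 + ‖f y‖ ^ 2) := by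
      nlinarith [sq_nonneg (‖f y‖ - ‖f y'‖)]
    calc _ ≤ w (y - y') * (1 / 2 * (‖f y'‖ ^ 2 + ‖f y‖ ^ 2)) := by gcongr
      _ = _ := by ring
  have i1 : Integrable (fun q : ℝ × ℝ => ‖f q.2‖ ^ 2 * w (q.1 - q.2)) (volume.prod volume) :=
    hf2.convolution_integrand (ContinuousLinearMap.mul ℝ ℝ) hw
  have i2 : Integrable (fun q : ℝ × ℝ => ‖f q.1‖ ^ 2 * w (q.1 - q.2)) (volume.prod volume) := by
    refine i1.swap.congr (Eventually.of_forall ?_)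
    rintro ⟨y, y'⟩
    simp only [Function.comp, Prod.swap]
    rw [← hwe, neg_sub]
  have v1 : ∫ q : ℝ × ℝ, ‖f q.2‖ ^ 2 * w (q.1 - q.2) ∂(volume.prod volume) =
      (∫ t, w t) * ∫ y, ‖f y‖ ^ 2 := by
    rw [integral_prod_symm _ i1]
    simp only
    rw [← integral_const_mul]
    refine integral_congr_ae (Eventually.of_forall fun y => ?_)
    simp only
    rw [integral_const_mul, integral_sub_right_eq_self w y, mul_comm]
  have v2 : ∫ q : ℝ × ℝ, ‖f q.1‖ ^ 2 * w (q.1 - q.2) ∂(volume.prod volume) =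
      (∫ t, w t) * ∫ y, ‖f y‖ ^ 2 := by
    rw [integral_prod _ i2]
    simp only
    rw [← integral_const_mul]
    refine integral_congr_ae (Eventually.of_forall fun y => ?_)
    simp only
    rw [integral_const_mul, integral_sub_left_eq_self w volume y, mul_comm]
  have fin : ‖((∫ x, ‖F x‖ ^ 2 : ℝ) : ℂ)‖ ≤ (∫ t, w t) * ∫ y, ‖f y‖ ^ 2 := by
    rw [e1, e2]
    refine (norm_integral_le_of_norm_le ((i1.add i2).const_mul (1 / 2))
      (Eventually.of_forall b1)).trans (le_of_eq ?_)
    rw [integral_const_mul]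
    simp only [Pi.add_apply]
    rw [integral_add i1 i2, v1, v2]
    ring
  rw [Complex.norm_real, Real.norm_eq_abs] at fin
  exact (le_abs_self _).trans fin

theorem _root_.eLpNorm_two_le_of_integral_le {F f : ℝ → ℂ} (hF : MemLp F 2 volume)
    (hf : MemLp f 2 volume) {B : ℝ} (hB : 0 ≤ B)
    (h : ∫ x, ‖F x‖ ^ 2 ≤ B ^ 2 * ∫ y, ‖f y‖ ^ 2) :
    eLpNorm F 2 volume ≤ ENNReal.ofReal B * eLpNorm f 2 volume := by
  have e : ∀ {g : ℝ → ℂ}, MemLp g 2 volume →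
      eLpNorm g 2 volume = ENNReal.ofReal (√(∫ y, ‖g y‖ ^ 2)) := by
    intro g hg
    rw [hg.eLpNorm_eq_integral_rpow_norm (by simp) (by simp)]
    simp [Real.sqrt_eq_rpow]
  rw [e hF, e hf, ← ENNReal.ofReal_mul hB]
  refine ENNReal.ofReal_le_ofReal ?_
  refine (Real.sqrt_le_sqrt h).trans (le_of_eq ?_)
  rw [Real.sqrt_mul (sq_nonneg B), Real.sqrt_sq hB]

/-- The `T*T` form of Schur's test. -/
theorem eLpNorm_le_of_adjoint_comp (h : IsBoxKernel κ M R) {w : ℝ → ℝ} (hw : Integrable w)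
    (hwe : ∀ t, w (-t) = w t)
    (hκ : ∀ y y', ‖∫ x, κ (x, y) * (starRingEnd ℂ) (κ (x, y'))‖ ≤ w (y - y'))
    {B : ℝ} (hB : 0 ≤ B) (hwB : ∫ t, w t ≤ B ^ 2) {f : ℝ → ℂ} (hf : MemLp f 2 volume) :
    eLpNorm (fun x => ∫ y, κ (x, y) * f y) 2 volume ≤ ENNReal.ofReal B * eLpNorm f 2 volume := by
  refine eLpNorm_two_le_of_integral_le (h.memLp hf) hf hB
    ((h.integral_norm_sq_le hw hwe hκ hf).trans ?_)
  have : 0 ≤ ∫ y, ‖f y‖ ^ 2 := integral_nonneg fun _ => by positivity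
  gcongr

/-- The `TT*` form of Schur's test. -/
theorem eLpNorm_le_of_comp_adjoint (h : IsBoxKernel κ M R) {w : ℝ → ℝ} (hw : Integrable w)
    (hwe : ∀ t, w (-t) = w t)
    (hκ : ∀ x x', ‖∫ y, κ (x, y) * (starRingEnd ℂ) (κ (x', y))‖ ≤ w (x - x'))
    {B : ℝ} (hB : 0 < B) (hwB : ∫ t, w t ≤ B ^ 2) {f : ℝ → ℂ} (hf : MemLp f 2 volume) :
    eLpNorm (fun x => ∫ y, κ (x, y) * f y) 2 volume ≤ ENNReal.ofReal B * eLpNorm f 2 volume := by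
  set F : ℝ → ℂ := fun x => ∫ y, κ (x, y) * f y with hF
  have hFL : MemLp F 2 volume := h.memLp hf
  set κ' : ℝ × ℝ → ℂ := fun p => (starRingEnd ℂ) (κ (p.2, p.1)) with hκ'
  have h' : IsBoxKernel κ' M R := h.transpose_conj
  set G : ℝ → ℂ := fun y => ∫ x, κ' (y, x) * F x with hG
  have hGL : MemLp G 2 volume := h'.memLp hFL
  have hGb : ∫ y, ‖G y‖ ^ 2 ≤ B ^ 2 * ∫ x, ‖F x‖ ^ 2 := by
    refine (h'.integral_norm_sq_le hw hwe (fun y y' => ?_) hFL).trans ?_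
    · refine le_trans (le_of_eq ?_) ((hκ y' y).trans (le_of_eq ?_))
      · congr 2
        ext x
        simp [hκ', mul_comm]
      · rw [← hwe, neg_sub]
    · have : 0 ≤ ∫ y, ‖F y‖ ^ 2 := integral_nonneg fun _ => by positivity
      gcongr
  have hf2 : Integrable (fun y => ‖f y‖ ^ 2) volume := (memLp_two_iff_integrable_sq_norm hf.1).1 hf
  have hG2 : Integrable (fun y => ‖G y‖ ^ 2) volume :=
    (memLp_two_iff_integrable_sq_norm hGL.1).1 hGL
  have hint : Integrable (fun p : ℝ × ℝ => κ p * f p.2 * (starRingEnd ℂ) (F p.1))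
      (volume.prod volume) := by
    have i1 := (integrable_indicator hFL R).mul_prod (integrable_indicator hf R)
    refine (i1.const_mul M).mono' ?_ (Eventually.of_forall ?_)
    · exact (h.measurable.aestronglyMeasurable.mul hf.1.comp_snd).mul
        (Complex.continuous_conj.comp_aestronglyMeasurable hFL.1.comp_fst)
    · rintro ⟨x, y⟩
      simp only
      by_cases h0 : κ (x, y) = 0
      · rw [h0, zero_mul, zero_mul, norm_zero]
        have i3 := Set.indicator_nonneg (s := Set.Icc (-R) R)
          (f := fun y => ‖f y‖) (fun _ _ => norm_nonneg _) y
        have i4 := Set.indicator_nonneg (s := Set.Icc (-R) R)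
          (f := fun y => ‖F y‖) (fun _ _ => norm_nonneg _) x
        exact mul_nonneg h.nonneg (mul_nonneg i4 i3)
      · rw [Set.indicator_of_mem (h.supp x y h0).1,
          Set.indicator_of_mem (h.supp x y h0).2, norm_mul, norm_mul, RCLike.norm_conj]
        have := h.bound (x, y)
        calc _ ≤ M * ‖f y‖ * ‖F x‖ := by gcongr
          _ = _ := by ring
  -- This is `‖Tf‖² = ⟨f, T*Tf⟩`. The `T*T` bound for the transposed kernel has already given `‖G‖ ≤
  -- B‖F‖` for `G = T*F`.
  have e1 : ((∫ x, ‖F x‖ ^ 2 : ℝ) : ℂ) = ∫ y, f y * (starRingEnd ℂ) (G y) := by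
    have : ((∫ x, ‖F x‖ ^ 2 : ℝ) : ℂ) = ∫ x, ∫ y, κ (x, y) * f y * (starRingEnd ℂ) (F x) := by
      rw [← integral_complex_ofReal]
      refine integral_congr_ae (Eventually.of_forall fun x => ?_)
      simp only
      rw [integral_mul_const, Complex.mul_conj, Complex.normSq_eq_norm_sq]
    rw [this, integral_integral_swap hint]
    refine integral_congr_ae (Eventually.of_forall fun y => ?_)
    simp only [hG]
    rw [← integral_conj, ← integral_const_mul]
    refine integral_congr_ae (Eventually.of_forall fun x => ?_)
    simp only [hκ', map_mul, Complex.conj_conj]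
    ring
  -- The weights in this arithmetic-geometric inequality are chosen so that the `G` term becomes at
  -- most half of `‖F‖²` and can be absorbed on the left.
  have e2 : ∫ x, ‖F x‖ ^ 2 ≤
      ∫ y, (B ^ 2 / 2 * ‖f y‖ ^ 2 + (2 * B ^ 2)⁻¹ * ‖G y‖ ^ 2) := by
    have hb : ‖((∫ x, ‖F x‖ ^ 2 : ℝ) : ℂ)‖ ≤
        ∫ y, (B ^ 2 / 2 * ‖f y‖ ^ 2 + (2 * B ^ 2)⁻¹ * ‖G y‖ ^ 2) := by
      rw [e1]
      refine norm_integral_le_of_norm_le ((hf2.const_mul (B ^ 2 / 2)).add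
        (hG2.const_mul (2 * B ^ 2)⁻¹)) (Eventually.of_forall fun y => ?_)
      rw [norm_mul, RCLike.norm_conj]
      have : B ^ 2 / 2 * ‖f y‖ ^ 2 + (2 * B ^ 2)⁻¹ * ‖G y‖ ^ 2 - ‖f y‖ * ‖G y‖ =
        (B * ‖f y‖ - B⁻¹ * ‖G y‖) ^ 2 / 2 := by
        field_simp; ring
      nlinarith [sq_nonneg (B * ‖f y‖ - B⁻¹ * ‖G y‖)]
    rw [Complex.norm_real, Real.norm_eq_abs] at hb
    exact (le_abs_self _).trans hb
  rw [integral_add (hf2.const_mul _) (hG2.const_mul _), integral_const_mul, integral_const_mul] at e2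
  refine eLpNorm_two_le_of_integral_le hFL hf hB.le ?_
  have e3 : (2 * B ^ 2)⁻¹ * ∫ y, ‖G y‖ ^ 2 ≤ 1 / 2 * ∫ x, ‖F x‖ ^ 2 := by
    calc _ ≤ (2 * B ^ 2)⁻¹ * (B ^ 2 * ∫ x, ‖F x‖ ^ 2) := by gcongr
      _ = _ := by field_simp
  linarith

end IsBoxKernel

/-! ### The phase, its derivatives and the exchange of the variables -/

/-- The partial derivative `∂_x^i ∂_y^j` of the phase. -/
noncomputable def phaseD (n : ℕ) (a : ℕ → ℝ) (i j : ℕ) (x y : ℝ) : ℝ :=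
  ∑ k ∈ Finset.Icc 1 (n - 1), a k * (((n - k).descFactorial i * x ^ (n - k - i)) *
    (k.descFactorial j * y ^ (k - j)))

theorem phaseD_zero_zero (n : ℕ) (a : ℕ → ℝ) (x y : ℝ) : phaseD n a 0 0 x y = phase n a x y := by
  simp [phaseD, phase, mul_assoc]

/-- Truncated subtraction does no harm: once the exponent has reached `0`, the new factor `N - i` of
the descending factorial vanishes. -/
theorem hasDerivAt_descFactorial_mul_pow (N i : ℕ) (x : ℝ) :
    HasDerivAt (fun x : ℝ => (N.descFactorial i : ℝ) * x ^ (N - i))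
      (N.descFactorial (i + 1) * x ^ (N - (i + 1))) x := by
  refine ((hasDerivAt_pow (N - i) x).const_mul _).congr_deriv ?_
  rw [Nat.descFactorial_succ, Nat.cast_mul, Nat.sub_sub]
  ring

theorem hasDerivAt_phaseD_left (n : ℕ) (a : ℕ → ℝ) (i j : ℕ) (x y : ℝ) :
    HasDerivAt (fun x => phaseD n a i j x y) (phaseD n a (i + 1) j x y) x :=
  HasDerivAt.fun_sum fun k _ =>
    ((hasDerivAt_descFactorial_mul_pow (n - k) i x).mul_const _).const_mul (a k)

theorem hasDerivAt_phaseD_right (n : ℕ) (a : ℕ → ℝ) (i j : ℕ) (x y : ℝ) :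
    HasDerivAt (fun y => phaseD n a i j x y) (phaseD n a i (j + 1) x y) y :=
  HasDerivAt.fun_sum fun k _ =>
    ((hasDerivAt_descFactorial_mul_pow k j y).const_mul _).const_mul (a k)

theorem contDiff_phaseD_right (n : ℕ) (a : ℕ → ℝ) (i j : ℕ) (x : ℝ) {m : WithTop ℕ∞} :
    ContDiff ℝ m fun y => phaseD n a i j x y := by
  unfold phaseD; fun_prop

theorem continuous_phaseD (n : ℕ) (a : ℕ → ℝ) (i j : ℕ) :
    Continuous fun p : ℝ × ℝ => phaseD n a i j p.1 p.2 := by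
  unfold phaseD; fun_prop

theorem mixedHessian_phase (n : ℕ) (a : ℕ → ℝ) (x y : ℝ) :
    mixedHessian (phase n a) x y = phaseD n a 1 1 x y := by
  have h : ∀ u, deriv (fun v => phase n a u v) y = phaseD n a 0 1 u y := fun u => by
    simp only [← phaseD_zero_zero]
    exact (hasDerivAt_phaseD_right n a 0 0 u y).deriv
  simp only [mixedHessian, h]
  exact (hasDerivAt_phaseD_left n a 0 1 x y).deriv

theorem phaseD_swap (n : ℕ) (a : ℕ → ℝ) (i j : ℕ) (x y : ℝ) :
    phaseD n (fun k => a (n - k)) i j x y = phaseD n a j i y x := by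
  refine Finset.sum_nbij' (fun k => n - k) (fun k => n - k) ?_ ?_ ?_ ?_ ?_
  · intro k hk; rw [Finset.mem_Icc] at *; omega
  · intro k hk; rw [Finset.mem_Icc] at *; omega
  · intro k hk; rw [Finset.mem_Icc] at *; omega
  · intro k hk; rw [Finset.mem_Icc] at *; omega
  · intro k hk
    rw [Finset.mem_Icc] at hk
    have : n - (n - k) = k := by omega
    rw [this]
    ring

theorem phase_swap (n : ℕ) (a : ℕ → ℝ) (x y : ℝ) :
    phase n (fun k => a (n - k)) x y = phase n a y x := by
  rw [← phaseD_zero_zero, ← phaseD_zero_zero, phaseD_swap]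

theorem mixedHessian_phase_swap (n : ℕ) (a : ℕ → ℝ) (x y : ℝ) :
    mixedHessian (phase n fun k => a (n - k)) x y = mixedHessian (phase n a) y x := by
  rw [mixedHessian_phase, mixedHessian_phase, phaseD_swap]

/-- A quadratic form on the plane with the two coordinates exchanged. -/
noncomputable def swapForm (Q : QuadraticForm ℝ (ℝ × ℝ)) : QuadraticForm ℝ (ℝ × ℝ) :=
  Q.comp (LinearEquiv.prodComm ℝ ℝ ℝ : ℝ × ℝ →ₗ[ℝ] ℝ × ℝ)

theorem swapForm_apply (Q : QuadraticForm ℝ (ℝ × ℝ)) (x y : ℝ) :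
    swapForm Q (x, y) = Q (y, x) := rfl

theorem swapForm_posDef {Q : QuadraticForm ℝ (ℝ × ℝ)} (hQ : Q.PosDef) : (swapForm Q).PosDef := by
  rintro ⟨x, y⟩ h
  rw [swapForm_apply]
  refine hQ _ fun h0 => h ?_
  simp only [Prod.mk_eq_zero] at h0 ⊢
  exact h0.symm

/-- Write `x - α y = -α (y - α⁻¹ x)` and move the factors `-α` into `c`. This costs nothing, since
no estimate depends on `c`. -/
theorem HessianFactors.swap {n : ℕ} {a : ℕ → ℝ} {c : ℝ} {s r : ℕ} {α : Fin s → ℝ}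
    {m : Fin s → ℕ} {Q : Fin r → QuadraticForm ℝ (ℝ × ℝ)}
    (h : HessianFactors n (phase n a) c α m Q) :
    HessianFactors n (phase n fun k => a (n - k)) (c * ∏ l, (-α l) ^ m l) (fun l => (α l)⁻¹) m
      (fun l => swapForm (Q l)) where
  c_ne := mul_ne_zero h.c_ne (Finset.prod_ne_zero_iff.2 fun l _ =>
    pow_ne_zero _ (neg_ne_zero.2 (h.α_ne l)))
  α_ne l := inv_ne_zero (h.α_ne l)
  posDef l := swapForm_posDef (h.posDef l)
  degree := h.degree
  eq x y := by
    rw [mixedHessian_phase_swap, h.eq]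
    simp only [swapForm_apply]
    congr 1
    rw [mul_assoc, ← Finset.prod_mul_distrib]
    congr 1
    refine Finset.prod_congr rfl fun l _ => ?_
    rw [← mul_pow]
    congr 1
    have := h.α_ne l
    field_simp
    ring

theorem DominatesLines.swap {𝒦 : ℝ} {s : ℕ} {α : Fin s → ℝ} (hα : ∀ l, α l ≠ 0)
    (h : DominatesLines 𝒦 α) : DominatesLines 𝒦 fun l => (α l)⁻¹ := by
  refine ⟨h.1, fun l => ?_⟩
  have h0 : 0 < |α l| := abs_pos.2 (hα l)
  have := h.2 l
  rw [abs_inv]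
  constructor
  · rw [← div_eq_mul_inv, div_le_iff₀ h0]; exact this.2
  · rw [← div_eq_mul_inv, le_div_iff₀ h0]; exact this.1

/-! ### Size of the forms and of the Hessian on the sector -/

/-- On the sector `2^𝒦 x ≤ 4 y` the form `Q(x,y)` is comparable to `Q(0,1) y²`. -/
def FormBound (𝒦 κ : ℝ) (Q : QuadraticForm ℝ (ℝ × ℝ)) : Prop :=
  ∀ x y : ℝ, 0 ≤ x → 0 < y → x * (2 : ℝ) ^ 𝒦 ≤ 4 * y →
    Q (0, 1) * y ^ 2 ≤ κ * Q (x, y) ∧ Q (1, 0) * x ^ 2 ≤ κ * (Q (0, 1) * y ^ 2)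

theorem exists_form_expansion (Q : QuadraticForm ℝ (ℝ × ℝ)) :
    ∃ b, ∀ x y : ℝ, Q (x, y) = Q (1, 0) * x ^ 2 + b * (x * y) + Q (0, 1) * y ^ 2 := by
  refine ⟨QuadraticMap.polar Q (1, 0) (0, 1), fun x y => ?_⟩
  have h : ((x, y) : ℝ × ℝ) = x • (1, 0) + y • (0, 1) := by ext <;> simp
  rw [h, QuadraticMap.map_add Q, QuadraticMap.map_smul, QuadraticMap.map_smul,
    QuadraticMap.polar_smul_left, QuadraticMap.polar_smul_right]
  simp only [smul_eq_mul]
  ring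

theorem FormBound.mono {𝒦 κ κ' : ℝ} {Q : QuadraticForm ℝ (ℝ × ℝ)} (hQ : Q.PosDef)
    (h : FormBound 𝒦 κ Q) (hκ : κ ≤ κ') : FormBound 𝒦 κ' Q := by
  intro x y hx hy hxy
  obtain ⟨h1, h2⟩ := h x y hx hy hxy
  have q1 : 0 ≤ Q (x, y) := hQ.nonneg _
  have q2 : 0 ≤ Q (0, 1) := hQ.nonneg _
  exact ⟨h1.trans (by gcongr), h2.trans (by gcongr)⟩

/-- Largeness of `𝒦` gives `Q(1,0)x² ≤ Q(0,1)y²/4`, while `Q(2x,y) ≥ 0` bounds the cross term below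
by `-2Q(1,0)x² - Q(0,1)y²/2`. Together they leave `Q(x,y) ≥ Q(0,1)y²/4`. -/
theorem formBound_of_dominates {𝒦 : ℝ} {Q : QuadraticForm ℝ (ℝ × ℝ)} (hQ : Q.PosDef)
    (h : 8 ^ 2 * Q (1, 0) ≤ ((2 : ℝ) ^ 𝒦) ^ 2 * Q (0, 1)) : FormBound 𝒦 4 Q := by
  intro x y hx hy hxy
  obtain ⟨b, hb⟩ := exists_form_expansion Q
  have q2 : 0 ≤ Q (0, 1) := hQ.nonneg _
  have h1 : (x * (2 : ℝ) ^ 𝒦) ^ 2 ≤ (4 * y) ^ 2 := by gcongr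
  have h2 : Q (1, 0) * x ^ 2 ≤ Q (0, 1) * y ^ 2 / 4 := by
    nlinarith [mul_le_mul_of_nonneg_left h1 q2, mul_le_mul_of_nonneg_right h (sq_nonneg x)]
  have h3 : 0 ≤ Q (2 * x, y) := hQ.nonneg _
  rw [hb] at h3
  rw [hb x y]
  constructor <;> nlinarith [mul_nonneg q2 (sq_nonneg y)]

/-- With `A = Q(1,0)`, `D = Q(0,1)` and cross coefficient `b`, completing the square gives
`4A·Q(x,y) ≥ (4AD - b²) y²`. The constant thus depends on the discriminant of `Q`; the sector is
needed only to bound the `x²` term. -/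
theorem exists_formBound (𝒦 : ℝ) {Q : QuadraticForm ℝ (ℝ × ℝ)} (hQ : Q.PosDef) :
    ∃ κ, FormBound 𝒦 κ Q := by
  obtain ⟨b, hb⟩ := exists_form_expansion Q
  have q1 : 0 < Q (1, 0) := hQ _ (by simp)
  have q2 : 0 < Q (0, 1) := hQ _ (by simp)
  set A := Q (1, 0)
  set D := Q (0, 1)
  have hdisc : 0 < 4 * A * D - b ^ 2 := by
    -- The value of `Q` at this point is `A(4AD - b²)`.
    have h := hQ (-b, 2 * A) (by simp [q1.ne'])
    rw [hb] at h
    nlinarith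
  set P := (2 : ℝ) ^ 𝒦
  have hP : 0 < P := by positivity
  refine ⟨4 * A * D / (4 * A * D - b ^ 2) + A * (4 / P) ^ 2 / D, fun x y hx hy hxy => ?_⟩
  have h0 : 0 ≤ Q (x, y) := hQ.nonneg _
  constructor
  · rw [add_mul]
    have : D * y ^ 2 ≤ 4 * A * D / (4 * A * D - b ^ 2) * Q (x, y) := by
      rw [div_mul_eq_mul_div, le_div_iff₀ hdisc, hb]
      nlinarith [mul_nonneg q2.le (sq_nonneg (2 * A * x + b * y))]
    have : 0 ≤ A * (4 / P) ^ 2 / D * Q (x, y) := by positivity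
    linarith
  · rw [add_mul]
    have h1 : x ≤ 4 / P * y := by
      rw [div_mul_eq_mul_div, le_div_iff₀ hP]; exact hxy
    have : A * x ^ 2 ≤ A * (4 / P) ^ 2 / D * (D * y ^ 2) := by
      calc A * x ^ 2 ≤ A * (4 / P * y) ^ 2 := by gcongr
        _ = _ := by field_simp
    have : 0 ≤ 4 * A * D / (4 * A * D - b ^ 2) * (D * y ^ 2) := by positivity
    linarith

theorem symbolAt_linear {x y α : ℝ} (hy : 0 < y) (h : |α * x| ≤ y / 2) :
    SymbolAt (fun t => ((t - α * x : ℝ) : ℂ)) y (3 * y) := by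
  have h1 : ∀ t : ℝ, HasDerivAt (fun t : ℝ => ((t - α * x : ℝ) : ℂ)) 1 t := fun t => by
    simpa using ((hasDerivAt_id t).sub_const (α * x)).ofReal_comp
  refine SymbolAt.of_hasDerivAt (f' := fun _ => 1) (f'' := 0)
    (Complex.ofRealCLM.contDiff.comp (contDiff_id.sub contDiff_const)).contDiffAt
    (Eventually.of_forall h1) (hasDerivAt_const y 1) ?_
  have h2 := abs_sub y (α * x)
  rw [abs_of_pos hy] at h2
  simp only [Complex.norm_real, Real.norm_eq_abs, norm_one, norm_zero]
  linarith

theorem symbolAt_form {𝒦 κ x y : ℝ} {Q : QuadraticForm ℝ (ℝ × ℝ)} (hQ : Q.PosDef)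
    (h : FormBound 𝒦 κ Q) (hκ : 1 ≤ κ) (hx : 0 ≤ x) (hy : 0 < y)
    (hxy : x * (2 : ℝ) ^ 𝒦 ≤ 4 * y) :
    SymbolAt (fun t => ((Q (x, t) : ℝ) : ℂ)) y (9 * κ * (Q (0, 1) * y ^ 2)) := by
  obtain ⟨b, hb⟩ := exists_form_expansion Q
  have hup := (h x y hx hy hxy).2
  have p1 : 0 ≤ Q (x, y) := hQ.nonneg _
  have p2 : 0 ≤ Q (x, -y) := hQ.nonneg _
  have q1 : 0 ≤ Q (1, 0) * x ^ 2 := mul_nonneg (hQ.nonneg _) (sq_nonneg x)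
  have q2 : 0 ≤ Q (0, 1) := hQ.nonneg _
  have h1 : ∀ t : ℝ, HasDerivAt (fun t : ℝ => ((Q (x, t) : ℝ) : ℂ))
      ((b * x + 2 * Q (0, 1) * t : ℝ) : ℂ) t := fun t => by
    simp only [hb x]
    refine HasDerivAt.ofReal_comp ?_
    have := ((((hasDerivAt_id t).const_mul x).const_mul b).const_add (Q (1, 0) * x ^ 2)).add
      (((hasDerivAt_id t).pow 2).const_mul (Q (0, 1)))
    refine this.congr_deriv ?_
    simp; ring
  have h2 : HasDerivAt (fun t : ℝ => ((b * x + 2 * Q (0, 1) * t : ℝ) : ℂ))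
      ((2 * Q (0, 1) : ℝ) : ℂ) y := by
    refine HasDerivAt.ofReal_comp ?_
    simpa using ((hasDerivAt_id y).const_mul (2 * Q (0, 1))).const_add (b * x)
  have hcd : ContDiff ℝ 2 fun t : ℝ => ((Q (x, t) : ℝ) : ℂ) := by
    simp only [hb x]
    exact Complex.ofRealCLM.contDiff.comp ((contDiff_const.add (contDiff_const.mul
      (contDiff_const.mul contDiff_id))).add (contDiff_const.mul (contDiff_id.pow 2)))
  refine SymbolAt.of_hasDerivAt hcd.contDiffAt (Eventually.of_forall h1) h2 ?_
  simp only [Complex.norm_real, Real.norm_eq_abs]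
  rw [abs_of_nonneg p1, abs_of_nonneg (by positivity : 0 ≤ 2 * Q (0, 1))]
  -- Positivity at `(x, y)` and at `(x, -y)` yields `|bxy| ≤ Q(1,0)x² + Q(0,1)y²`. Adding up the jet
  -- gives `3Q(1,0)x² + 6Q(0,1)y²`, hence the constant `9κ`.
  have e : y * |b * x + 2 * Q (0, 1) * y| ≤
      Q (1, 0) * x ^ 2 + Q (0, 1) * y ^ 2 + 2 * (Q (0, 1) * y ^ 2) := by
    rw [← abs_of_pos hy, ← abs_mul, abs_of_pos hy, abs_le]
    rw [hb] at p1 p2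
    constructor <;> nlinarith [mul_nonneg q2 (sq_nonneg y)]
  have e2 : Q (x, y) ≤ 2 * (Q (1, 0) * x ^ 2 + Q (0, 1) * y ^ 2) := by
    rw [hb] at p1 p2 ⊢
    nlinarith
  have e3 : Q (0, 1) * y ^ 2 ≤ κ * (Q (0, 1) * y ^ 2) :=
    le_mul_of_one_le_left (by positivity) hκ
  linarith

/-- The size `|c| ∏ Q_l(0,1) y^{n-2}` of the Hessian in the sector where `y` dominates. -/
noncomputable def hessianSize (n : ℕ) (c : ℝ) {r : ℕ} (Q : Fin r → QuadraticForm ℝ (ℝ × ℝ))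
    (y : ℝ) : ℝ :=
  |c| * (∏ l, Q l (0, 1)) * y ^ (n - 2)

section Hessian

variable {n : ℕ} {a : ℕ → ℝ} {c : ℝ} {s r : ℕ} {α : Fin s → ℝ} {m : Fin s → ℕ}
  {Q : Fin r → QuadraticForm ℝ (ℝ × ℝ)} {𝒦 κ x y : ℝ}

theorem HessianFactors.hessianSize_pos (h : HessianFactors n (phase n a) c α m Q) (hy : 0 < y) :
    0 < hessianSize n c Q y := by
  have : 0 < ∏ l, Q l (0, 1) := Finset.prod_pos fun l _ => h.posDef l _ (by simp)
  have := abs_pos.2 h.c_ne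
  unfold hessianSize
  positivity

theorem HessianFactors.prod_eq_hessianSize (h : HessianFactors n (phase n a) c α m Q)
    (u v y : ℝ) :
    |c| * (∏ l, (u * y) ^ m l) * ∏ l, v * (Q l (0, 1) * y ^ 2) =
      u ^ (∑ l, m l) * v ^ r * hessianSize n c Q y := by
  have hn : n - 2 = (∑ l, m l) + 2 * r := by have := h.degree; omega
  rw [hessianSize, hn, Finset.prod_pow_eq_pow_sum, Finset.prod_mul_distrib,
    Finset.prod_mul_distrib, Finset.prod_const, Finset.prod_const, Finset.card_univ,
    Fintype.card_fin]
  ring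

theorem DominatesLines.abs_mul_le (hα : DominatesLines 𝒦 α) (hx : 0 ≤ x)
    (hxy : x * (2 : ℝ) ^ 𝒦 ≤ 4 * y) (l : Fin s) : |α l * x| ≤ y / 2 := by
  rw [abs_mul, abs_of_nonneg hx]
  nlinarith [mul_le_mul_of_nonneg_right (hα.2 l).1 hx]

/-- Multiply the symbol bounds `3y` of the linear factors and `9κ Q_l(0,1)y²` of the forms. The
total degree is at most `n`, so the constant sees neither the `α_l` nor the `m_l`. -/
theorem HessianFactors.symbolAt (h : HessianFactors n (phase n a) c α m Q)
    (hα : DominatesLines 𝒦 α) (hQ : ∀ l, FormBound 𝒦 κ (Q l)) (hκ : 1 ≤ κ) (hx : 0 ≤ x)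
    (hy : 0 < y) (hxy : x * (2 : ℝ) ^ 𝒦 ≤ 4 * y) :
    SymbolAt (fun t => ((mixedHessian (phase n a) x t : ℝ) : ℂ)) y
      ((3 * κ) ^ n * hessianSize n c Q y) := by
  have h1 := (SymbolAt.prod Finset.univ (fun l _ =>
    (symbolAt_linear hy (hα.abs_mul_le hx hxy l)).pow hy.le (m l)) hy.le)
  have h2 := (SymbolAt.prod Finset.univ (fun l _ =>
    symbolAt_form (h.posDef l) (hQ l) hκ hx hy hxy) hy.le)
  have h3 := (((SymbolAt.const (c : ℂ) y).mul h1 hy.le).mul h2 hy.le)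
  have e : (fun t => ((mixedHessian (phase n a) x t : ℝ) : ℂ)) = fun t =>
      (c : ℂ) * (∏ l, ((t - α l * x : ℝ) : ℂ) ^ m l) * ∏ l, ((Q l (x, t) : ℝ) : ℂ) := by
    funext t
    rw [h.eq]
    push_cast
    rfl
  rw [e]
  refine h3.mono ?_
  rw [Complex.norm_real, Real.norm_eq_abs, h.prod_eq_hessianSize]
  have h4 := (h.hessianSize_pos hy).le
  have hn := h.degree
  gcongr
  calc (3 : ℝ) ^ (∑ l, m l) * (9 * κ) ^ r = 3 ^ ((∑ l, m l) + 2 * r) * κ ^ r := by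
        rw [pow_add, pow_mul, mul_pow]; norm_num; ring
    _ ≤ 3 ^ n * κ ^ n := by
        gcongr <;> first | omega | assumption | norm_num
    _ = _ := (mul_pow _ _ _).symm

/-- On the sector each linear factor is at least `y/2` and each form at least `κ⁻¹ Q_l(0,1) y²`; the
degree count again removes the dependence on the factorization. -/
theorem HessianFactors.hessianSize_le (h : HessianFactors n (phase n a) c α m Q)
    (hα : DominatesLines 𝒦 α) (hQ : ∀ l, FormBound 𝒦 κ (Q l)) (hκ : 1 ≤ κ) (hx : 0 ≤ x)
    (hy : 0 < y) (hxy : x * (2 : ℝ) ^ 𝒦 ≤ 4 * y) :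
    hessianSize n c Q y ≤ (2 * κ) ^ n * |mixedHessian (phase n a) x y| := by
  have hκ0 : 0 < κ := by linarith
  have hn := h.degree
  have h4 := (h.hessianSize_pos hy).le
  have h1 : (1 / 2 : ℝ) ^ (∑ l, m l) * κ⁻¹ ^ r * hessianSize n c Q y ≤
      |mixedHessian (phase n a) x y| := by
    rw [h.eq, abs_mul, abs_mul, Finset.abs_prod, Finset.abs_prod, ← h.prod_eq_hessianSize]
    have hy2 : 0 ≤ 1 / 2 * y := by positivity
    have hq : ∀ l, 0 ≤ κ⁻¹ * (Q l (0, 1) * y ^ 2) := fun l => by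
      have := h.posDef l (0, 1) (by simp)
      positivity
    gcongr with l _ l _
    · exact Finset.prod_nonneg fun l _ => hq l
    · rw [abs_pow]
      refine pow_le_pow_left₀ hy2 ?_ _
      have h2 := hα.abs_mul_le hx hxy l
      have h3 := le_abs_self (α l * x)
      rw [abs_of_nonneg (by linarith)]
      linarith
    · exact fun l _ => hq l
    · have h2 := (hQ l x y hx hy hxy).1
      rw [inv_mul_le_iff₀ hκ0]
      exact h2.trans (by gcongr; exact le_abs_self _)
  have h2 : (2 : ℝ) ^ (∑ l, m l) * κ ^ r ≤ (2 * κ) ^ n := by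
    rw [mul_pow]
    gcongr <;> first | omega | assumption | norm_num
  calc hessianSize n c Q y = (2 : ℝ) ^ (∑ l, m l) * κ ^ r *
        ((1 / 2 : ℝ) ^ (∑ l, m l) * κ⁻¹ ^ r * hessianSize n c Q y) := by
        rw [one_div, inv_pow, inv_pow]; field_simp
    _ ≤ _ := by gcongr

end Hessian

/-! ### Phase differences -/

/-- The `y`-derivative of the phase difference `λ (S(x,y) - S(x',y))` inherits symbol bounds from
the mixed Hessian. -/
theorem symbolAt_phase_difference (n : ℕ) (a : ℕ → ℝ) {lam x x' y P : ℝ} (hlam : 0 ≤ lam)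
    (hy : 0 < y) (h : ∀ t ∈ Set.uIcc x' x,
      SymbolAt (fun v => ((mixedHessian (phase n a) t v : ℝ) : ℂ)) y P) :
    SymbolAt (fun v => ((lam * (phaseD n a 0 1 x v - phaseD n a 0 1 x' v) : ℝ) : ℂ)) y
      (lam * |x - x'| * (3 * P)) := by
  simp only [mixedHessian_phase] at h
  have hd : ∀ i j t v, HasDerivAt (fun v => ((phaseD n a i j t v : ℝ) : ℂ))
      ((phaseD n a i (j + 1) t v : ℝ) : ℂ) v := fun i j t v =>
    (hasDerivAt_phaseD_right n a i j t v).ofReal_comp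
  -- The mean value inequality in `x` turns bounds for `∂_x ∂_y^j S` on the segment into bounds for
  -- differences of `∂_y^j S`, at the price of `|x - x'|`.
  have hmv : ∀ j B, (∀ t ∈ Set.uIcc x' x, |phaseD n a 1 j t y| ≤ B) →
      |phaseD n a 0 j x y - phaseD n a 0 j x' y| ≤ B * |x - x'| := fun j B hB =>
    (convex_uIcc x' x).norm_image_sub_le_of_norm_hasDerivWithin_le
      (fun t _ => (hasDerivAt_phaseD_left n a 0 j t y).hasDerivWithinAt) hB
      Set.left_mem_uIcc Set.right_mem_uIcc
  have hder : ∀ t, deriv (fun v => ((phaseD n a 1 1 t v : ℝ) : ℂ)) =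
      fun v => ((phaseD n a 1 2 t v : ℝ) : ℂ) := fun t => funext fun v => (hd 1 1 t v).deriv
  have hder2 : ∀ t, deriv (fun v => ((phaseD n a 1 2 t v : ℝ) : ℂ)) =
      fun v => ((phaseD n a 1 3 t v : ℝ) : ℂ) := fun t => funext fun v => (hd 1 2 t v).deriv
  have b1 := hmv 1 P fun t ht => by simpa using (h t ht).norm_le hy.le
  have b2 := hmv 2 (P / y) fun t ht => by
    have := (h t ht).deriv_le
    rw [hder, Complex.norm_real, Real.norm_eq_abs] at this
    rwa [le_div_iff₀' hy]
  have b3 := hmv 3 (2 * P / y ^ 2) fun t ht => by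
    have := (h t ht).deriv_deriv_le hy.le
    rw [hder, hder2, Complex.norm_real, Real.norm_eq_abs] at this
    rwa [le_div_iff₀' (by positivity)]
  have hD : ∀ j v, HasDerivAt
      (fun v => ((lam * (phaseD n a 0 j x v - phaseD n a 0 j x' v) : ℝ) : ℂ))
      ((lam * (phaseD n a 0 (j + 1) x v - phaseD n a 0 (j + 1) x' v) : ℝ) : ℂ) v := fun j v =>
    (((hasDerivAt_phaseD_right n a 0 j x v).sub
      (hasDerivAt_phaseD_right n a 0 j x' v)).const_mul lam).ofReal_comp
  have hcd : ContDiff ℝ 2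
      fun v => ((lam * (phaseD n a 0 1 x v - phaseD n a 0 1 x' v) : ℝ) : ℂ) :=
    Complex.ofRealCLM.contDiff.comp (contDiff_const.mul
      ((contDiff_phaseD_right n a 0 1 x).sub (contDiff_phaseD_right n a 0 1 x')))
  refine SymbolAt.of_hasDerivAt hcd.contDiffAt (Eventually.of_forall (hD 1)) (hD 2 y) ?_
  simp only [Complex.norm_real, Real.norm_eq_abs, abs_mul, abs_of_nonneg hlam]
  calc _ ≤ lam * (P * |x - x'|) + y * (lam * (P / y * |x - x'|)) +
      y ^ 2 / 2 * (lam * (2 * P / y ^ 2 * |x - x'|)) := by gcongr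
    _ = _ := by field_simp; ring

/-- By the mean value theorem the difference is `x - x'` times the Hessian at one intermediate
point, so a lower bound for its absolute value suffices and its sign plays no role. -/
theorem le_abs_phase_difference (n : ℕ) (a : ℕ → ℝ) {lam x x' y B : ℝ} (hlam : 0 ≤ lam)
    (h : ∀ t ∈ Set.uIcc x' x, B ≤ |mixedHessian (phase n a) t y|) :
    lam * |x - x'| * B ≤ |lam * (phaseD n a 0 1 x y - phaseD n a 0 1 x' y)| := by
  rw [abs_mul, abs_of_nonneg hlam, mul_assoc]
  refine mul_le_mul_of_nonneg_left ?_ hlam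
  have key : ∀ u v, u < v → (∀ t ∈ Set.Icc u v, B ≤ |mixedHessian (phase n a) t y|) →
      |v - u| * B ≤ |phaseD n a 0 1 v y - phaseD n a 0 1 u y| := by
    intro u v huv hB
    have hd := fun t => hasDerivAt_phaseD_left n a 0 1 t y
    obtain ⟨t, ht, e⟩ := exists_hasDerivAt_eq_slope (fun t => phaseD n a 0 1 t y) _ huv
      (fun t _ => (hd t).continuousAt.continuousWithinAt) fun t _ => hd t
    have h1 := hB t ⟨ht.1.le, ht.2.le⟩
    rw [mixedHessian_phase, e, abs_div, le_div_iff₀ (abs_pos.2 (by linarith))] at h1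
    rwa [mul_comm]
  rcases lt_trichotomy x x' with hx | hx | hx
  · rw [abs_sub_comm x, abs_sub_comm (phaseD n a 0 1 x y)]
    rw [Set.uIcc_of_ge hx.le] at h
    exact key x x' hx h
  · simp [hx]
  · rw [Set.uIcc_of_le hx.le] at h
    exact key x' x hx h

/-! ### Symbol bounds for the amplitude -/

theorem SymbolAt.add {f g : ℝ → ℂ} {y M N : ℝ} (hf : SymbolAt f y M) (hg : SymbolAt g y N)
    (hy : 0 ≤ y) : SymbolAt (fun t => f t + g t) y (M + N) := by
  refine SymbolAt.of_hasDerivAt (hf.1.add hg.1) (f' := fun t => deriv f t + deriv g t)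
    (by filter_upwards [hf.1.eventually_hasDerivAt_of_two, hg.1.eventually_hasDerivAt_of_two]
          with t h1 h2 using h1.add h2)
    (hf.1.hasDerivAt_deriv_of_two.add hg.1.hasDerivAt_deriv_of_two) ?_
  have h1 := hf.2
  have h2 := hg.2
  have e1 := norm_add_le (f y) (g y)
  have e2 := mul_le_mul_of_nonneg_left (norm_add_le (deriv f y) (deriv g y)) hy
  have e3 := mul_le_mul_of_nonneg_left (norm_add_le (deriv (deriv f) y) (deriv (deriv g) y))
    (by positivity : 0 ≤ y ^ 2 / 2)
  linarith

theorem IsSingularKernel.nonneg {μ E : ℝ} {K : ℝ → ℝ → ℂ} (hK : IsSingularKernel μ E K) :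
    0 ≤ E := by
  have := (norm_nonneg _).trans (hK.bound 0 1 (by simp))
  simpa using this

/-- Here `|x - y| ≥ y/2`, so the singular bounds become `y^{-μ-i}` with a loss of at most `2^{i+1}`.
The jet weights give `2 + 4 + 8/2 = 10`. -/
theorem IsSingularKernel.symbolAt {μ E x y : ℝ} {K : ℝ → ℝ → ℂ} (hK : IsSingularKernel μ E K)
    (hμ0 : 0 < μ) (hμ1 : μ < 1) (hy : 0 < y) (hxy : x ≤ y / 2) :
    SymbolAt (fun t => K x t) y (10 * E * y ^ (-μ)) := by
  have hE := hK.nonneg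
  have hne : x ≠ y := by intro h; linarith
  have hcd : ContDiffAt ℝ 2 (fun t => K x t) y := by
    have h1 : ContDiffAt ℝ 2 (fun p : ℝ × ℝ => K p.1 p.2) (x, y) :=
      hK.contDiffOn.contDiffAt ((isOpen_ne_fun continuous_fst continuous_snd).mem_nhds hne)
    exact h1.comp y (f := fun t => (x, t)) (contDiffAt_const.prodMk contDiffAt_id)
  have hd : y / 2 ≤ |x - y| := by
    rw [abs_sub_comm]; exact le_trans (by linarith) (le_abs_self _)
  have b0 := hK.bound x y hne
  have b1 := hK.bound_y 1 (Or.inl rfl) x y hne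
  have b2 := hK.bound_y 2 (Or.inr rfl) x y hne
  rw [iteratedDeriv_one] at b1
  rw [iteratedDeriv_succ, iteratedDeriv_one] at b2
  have hr : ∀ i : ℕ, |x - y| ^ (-μ - i) ≤ 2 ^ (i + 1) * (y ^ (-μ) / y ^ i) := by
    intro i
    calc |x - y| ^ (-μ - i) ≤ (y / 2) ^ (-μ - i) :=
          Real.rpow_le_rpow_of_nonpos (by positivity) hd
            (by have : (0 : ℝ) ≤ i := by positivity
                linarith)
      _ = 2 ^ (μ + i) * (y ^ (-μ) / y ^ i) := by
          rw [Real.div_rpow hy.le (by norm_num), Real.rpow_sub hy, Real.rpow_natCast,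
            show -μ - (i : ℝ) = -(μ + i) by ring, Real.rpow_neg (by norm_num : (0 : ℝ) ≤ 2)]
          field_simp
      _ ≤ 2 ^ ((i + 1 : ℕ) : ℝ) * (y ^ (-μ) / y ^ i) := by
          gcongr
          · norm_num
          · push_cast; linarith
      _ = _ := by rw [Real.rpow_natCast]
  have r0 := hr 0
  have r1 := hr 1
  have r2 := hr 2
  have hyμ : 0 < y ^ (-μ) := by positivity
  simp only [Nat.cast_zero, sub_zero] at r0
  refine ⟨hcd, ?_⟩
  calc _ ≤ E * (2 ^ (0 + 1) * (y ^ (-μ) / y ^ 0)) + y * (E * (2 ^ (1 + 1) * (y ^ (-μ) / y ^ 1))) +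
        y ^ 2 / 2 * (E * (2 ^ (2 + 1) * (y ^ (-μ) / y ^ 2))) := by
        gcongr
        · exact b0.trans (by gcongr)
        · exact b1.trans (by gcongr)
        · exact b2.trans (by gcongr)
    _ = _ := by field_simp; ring

/-- The quantities `|s|^i |θ^{(i)}(s)|` are invariant under dilation, so one bound serves `θ(q·)`
for all `q`. This is what makes the cut-off bounds uniform in `λ` and in the dyadic scale. -/
theorem exists_dilation_bound {θ : ℝ → ℂ} (hθ : ContDiff ℝ ∞ θ) (hc : HasCompactSupport θ) :
    ∃ B, 0 ≤ B ∧ ∀ s, ‖θ s‖ ≤ B ∧ |s| * ‖deriv θ s‖ ≤ B ∧ s ^ 2 * ‖deriv (deriv θ) s‖ ≤ B := by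
  have h1 : ContDiff ℝ ∞ (deriv θ) := (contDiff_infty_iff_deriv.1 hθ).2
  have h2 : ContDiff ℝ ∞ (deriv (deriv θ)) := (contDiff_infty_iff_deriv.1 h1).2
  obtain ⟨B0, hB0⟩ := hc.exists_bound_of_continuous hθ.continuous
  obtain ⟨B1, hB1⟩ := (hc.deriv.mul_left (f := fun s : ℝ => (s : ℂ))).exists_bound_of_continuous
    (Complex.continuous_ofReal.mul h1.continuous)
  obtain ⟨B2, hB2⟩ :=
    (hc.deriv.deriv.mul_left (f := fun s : ℝ => (s : ℂ) ^ 2)).exists_bound_of_continuous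
      ((Complex.continuous_ofReal.pow 2).mul h2.continuous)
  refine ⟨|B0| + |B1| + |B2|, by positivity, fun s => ?_⟩
  have e0 := hB0 s
  have e1 := hB1 s
  have e2 := hB2 s
  simp only [Pi.mul_apply, norm_mul, norm_pow, Complex.norm_real, Real.norm_eq_abs, sq_abs]
    at e1 e2
  have := le_abs_self B0
  have := le_abs_self B1
  have := le_abs_self B2
  have := abs_nonneg B0
  have := abs_nonneg B1
  have := abs_nonneg B2
  refine ⟨?_, ?_, ?_⟩ <;> linarith

theorem IsCutoff.hasCompactSupport {φ : ℝ → ℝ} (hφ : IsCutoff φ) : HasCompactSupport φ :=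
  HasCompactSupport.of_support_subset_isCompact isCompact_Icc fun t ht => by
    have : ¬1 ≤ |t| := fun h => ht (hφ.eq_zero t h)
    exact abs_le.1 (not_le.1 this).le

theorem IsCutoff.exists_symbol_bound {φ : ℝ → ℝ} (hφ : IsCutoff φ) :
    ∃ B, 0 ≤ B ∧ ∀ L x y : ℝ, 0 < L → 0 < y → x ≤ y / 2 →
      SymbolAt (fun t => ((1 - φ ((x - t) * L) : ℝ) : ℂ)) y B := by
  have hc : HasCompactSupport fun t => ((φ t : ℝ) : ℂ) :=
    hφ.hasCompactSupport.comp_left (g := fun t : ℝ => (t : ℂ)) Complex.ofReal_zero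
  have hs : ContDiff ℝ ∞ fun t => ((φ t : ℝ) : ℂ) := Complex.ofRealCLM.contDiff.comp hφ.smooth
  obtain ⟨B, hB0, hB⟩ := exists_dilation_bound hs hc
  refine ⟨1 + 5 * B, by positivity, fun L x y hL hy hxy => ?_⟩
  have h1 : SymbolAt (fun t => ((φ (-L * t + x * L) : ℝ) : ℂ)) y (5 * B) := by
    refine SymbolAt.comp_affine (contDiff_infty.1 hs 2) (-L) (x * L) ?_
    obtain ⟨b0, b1, b2⟩ := hB (-L * y + x * L)
    set u := -L * y + x * L with hu
    -- The distance to the diagonal is at least `y/2`, so differentiating in `y` costs no more than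
    -- the argument `u` of the cut-off allows. The jet then sums to `1 + 2 + 4/2 = 5`.
    have hLu : y * |-L| ≤ 2 * |u| := by
      have : u = -(L * (y - x)) := by rw [hu]; ring
      rw [abs_neg, abs_of_pos hL, this, abs_neg, abs_of_pos (mul_pos hL (by linarith))]
      nlinarith
    have hLu2 : y ^ 2 * (-L) ^ 2 ≤ 4 * u ^ 2 := by
      have := pow_le_pow_left₀ (by positivity) hLu 2
      rw [mul_pow, mul_pow, sq_abs, sq_abs] at this
      linarith
    have c1 := mul_le_mul_of_nonneg_right hLu
      (norm_nonneg (deriv (fun t => ((φ t : ℝ) : ℂ)) u))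
    have c2 := mul_le_mul_of_nonneg_right hLu2
      (norm_nonneg (deriv (deriv (fun t => ((φ t : ℝ) : ℂ))) u))
    linarith
  have h2 := (SymbolAt.const 1 y).add ((SymbolAt.const (-1) y).mul h1 hy.le) hy.le
  simp only [norm_neg, norm_one, one_mul] at h2
  convert h2 using 1
  funext t
  rw [show (x - t) * L = -L * t + x * L by ring]
  push_cast
  ring

theorem IsDyadicPartition.eq_zero {Ψ : ℝ → ℝ} (hΨ : IsDyadicPartition Ψ) {t : ℝ}
    (ht : t ∉ Set.Icc (1 / 2 : ℝ) 2) : Ψ t = 0 := by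
  by_contra h
  exact ht (hΨ.supp (subset_tsupport _ h))

/-- The closed support may contain the endpoints, but continuity forces the value there to vanish.
This removes boundary terms in the integration by parts. -/
theorem IsDyadicPartition.eq_zero_half {Ψ : ℝ → ℝ} (hΨ : IsDyadicPartition Ψ) :
    Ψ (1 / 2) = 0 := by
  have h1 : Tendsto Ψ (𝓝[<] (1 / 2)) (𝓝 (Ψ (1 / 2))) :=
    hΨ.smooth.continuous.continuousAt.tendsto.mono_left nhdsWithin_le_nhds
  refine tendsto_nhds_unique h1 (tendsto_const_nhds.congr' ?_)
  filter_upwards [self_mem_nhdsWithin] with t ht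
  exact (hΨ.eq_zero fun h => absurd h.1 (not_le.2 ht)).symm

theorem IsDyadicPartition.eq_zero_two {Ψ : ℝ → ℝ} (hΨ : IsDyadicPartition Ψ) : Ψ 2 = 0 := by
  have h1 : Tendsto Ψ (𝓝[>] 2) (𝓝 (Ψ 2)) :=
    hΨ.smooth.continuous.continuousAt.tendsto.mono_left nhdsWithin_le_nhds
  refine tendsto_nhds_unique h1 (tendsto_const_nhds.congr' ?_)
  filter_upwards [self_mem_nhdsWithin] with t ht
  exact (hΨ.eq_zero fun h => absurd h.2 (not_le.2 ht)).symm

theorem IsDyadicPartition.hasCompactSupport {Ψ : ℝ → ℝ} (hΨ : IsDyadicPartition Ψ) :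
    HasCompactSupport Ψ :=
  HasCompactSupport.of_support_subset_isCompact (isCompact_Icc (a := (1 / 2 : ℝ)) (b := 2))
    ((subset_tsupport _).trans hΨ.supp)

theorem IsDyadicPartition.exists_symbol_bound {Ψ : ℝ → ℝ} (hΨ : IsDyadicPartition Ψ) :
    ∃ B, 0 ≤ B ∧ ∀ q y : ℝ, 0 < q → 0 < y → SymbolAt (fun t => ((Ψ (q * t) : ℝ) : ℂ)) y B := by
  have hc : HasCompactSupport fun t => ((Ψ t : ℝ) : ℂ) :=
    hΨ.hasCompactSupport.comp_left (g := fun t : ℝ => (t : ℂ)) Complex.ofReal_zero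
  have hs : ContDiff ℝ ∞ fun t => ((Ψ t : ℝ) : ℂ) := Complex.ofRealCLM.contDiff.comp hΨ.smooth
  obtain ⟨B, hB0, hB⟩ := exists_dilation_bound hs hc
  refine ⟨3 * B, by positivity, fun q y hq hy => ?_⟩
  have h1 : SymbolAt (fun t => ((Ψ (q * t + 0) : ℝ) : ℂ)) y (3 * B) := by
    refine SymbolAt.comp_affine (contDiff_infty.1 hs 2) q 0 ?_
    obtain ⟨b0, b1, b2⟩ := hB (q * y + 0)
    rw [add_zero] at *
    rw [abs_mul, abs_of_pos hy] at b1
    nlinarith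
  simpa only [add_zero] using h1

theorem exists_symbol_bound_slice {ψ : ℝ × ℝ → ℂ} (hψ : ContDiff ℝ ∞ ψ)
    (hψc : HasCompactSupport ψ) :
    ∃ B, 0 ≤ B ∧ ∀ x y : ℝ, 0 < y → SymbolAt (fun t => ψ (x, t)) y B := by
  have hstep : ∀ ρ : ℝ × ℝ → ℂ, ContDiff ℝ ∞ ρ → HasCompactSupport ρ →
      ContDiff ℝ ∞ (fun p => fderiv ℝ ρ p (0, 1)) ∧
      HasCompactSupport (fun p => fderiv ℝ ρ p (0, 1)) ∧
      ∀ x y, HasDerivAt (fun t => ρ (x, t)) (fderiv ℝ ρ (x, y) (0, 1)) y := by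
    intro ρ h hc
    refine ⟨(h.fderiv_right (m := ∞) (by simp)).clm_apply contDiff_const,
      (hc.fderiv ℝ).comp_left (g := fun T : ℝ × ℝ →L[ℝ] ℂ => T (0, 1)) rfl, fun x y => ?_⟩
    have h1 : HasFDerivAt ρ (fderiv ℝ ρ (x, y)) (x, y) :=
      (h.differentiable (by simp) (x, y)).hasFDerivAt
    exact h1.comp_hasDerivAt y ((hasDerivAt_const y x).prodMk (hasDerivAt_id y))
  obtain ⟨s1, c1, d1⟩ := hstep ψ hψ hψc
  obtain ⟨s2, c2, d2⟩ := hstep _ s1 c1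
  set ψ1 : ℝ × ℝ → ℂ := fun p => fderiv ℝ ψ p (0, 1)
  set ψ2 : ℝ × ℝ → ℂ := fun p => fderiv ℝ ψ1 p (0, 1)
  obtain ⟨B0, hB0⟩ := hψc.exists_bound_of_continuous hψ.continuous
  obtain ⟨B1, hB1⟩ := (c1.mul_left (f := fun p : ℝ × ℝ => (p.2 : ℂ))).exists_bound_of_continuous
    ((Complex.continuous_ofReal.comp continuous_snd).mul s1.continuous)
  obtain ⟨B2, hB2⟩ :=
    (c2.mul_left (f := fun p : ℝ × ℝ => (p.2 : ℂ) ^ 2)).exists_bound_of_continuous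
      (((Complex.continuous_ofReal.comp continuous_snd).pow 2).mul s2.continuous)
  refine ⟨|B0| + |B1| + |B2|, by positivity, fun x y hy => ?_⟩
  refine SymbolAt.of_hasDerivAt (f' := fun t => ψ1 (x, t)) (f'' := ψ2 (x, y))
    ((contDiff_infty.1 hψ 2).comp (contDiff_const.prodMk contDiff_id)).contDiffAt
    (Eventually.of_forall (d1 x)) (d2 x y) ?_
  have e0 := hB0 (x, y)
  have e1 := hB1 (x, y)
  have e2 := hB2 (x, y)
  simp only [Pi.mul_apply, norm_mul, norm_pow, Complex.norm_real, Real.norm_eq_abs, abs_of_pos hy]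
    at e1 e2
  have := le_abs_self B0
  have := le_abs_self B1
  have := le_abs_self B2
  have := abs_nonneg B2
  linarith

/-- The amplitude `K |S''|^z [1 - φ((x-y) λ^{1/n})] ψ`. -/
noncomputable def amplitude (n : ℕ) (S : ℝ → ℝ → ℝ) (K : ℝ → ℝ → ℂ) (φ : ℝ → ℝ) (ψ : ℝ × ℝ → ℂ)
    (z : ℂ) (lam x y : ℝ) : ℂ :=
  K x y * ((|mixedHessian S x y| : ℝ) : ℂ) ^ z *
    ((1 - φ ((x - y) * lam ^ ((1 : ℝ) / n)) : ℝ) : ℂ) * ψ (x, y)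

/-- The upper and lower bounds for the Hessian have a ratio free of `hessianSize`, so the complex
power costs only a constant times `√(hessianSize)`. The constant `B` is chosen before the phase, the
kernel and `λ`. -/
theorem exists_amplitude_bound (n : ℕ) {μ κ : ℝ} (hμ0 : 0 < μ) (hμ1 : μ < 1) (hκ : 1 ≤ κ)
    {φ : ℝ → ℝ} (hφ : IsCutoff φ) {ψ : ℝ × ℝ → ℂ} (hψ : ContDiff ℝ ∞ ψ)
    (hψc : HasCompactSupport ψ) {z : ℂ} (hz : z.re = 1 / 2) :
    ∃ B, 0 ≤ B ∧ ∀ (E 𝒦 : ℝ) (r : ℕ) (Q : Fin r → QuadraticForm ℝ (ℝ × ℝ)) (s : ℕ)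
      (α : Fin s → ℝ) (m : Fin s → ℕ) (c : ℝ) (a : ℕ → ℝ),
      HessianFactors n (phase n a) c α m Q → DominatesLines 𝒦 α → (∀ l, FormBound 𝒦 κ (Q l)) →
      ∀ K : ℝ → ℝ → ℂ, IsSingularKernel μ E K → ∀ lam : ℝ, 0 < lam → ∀ x y : ℝ, 0 ≤ x → 0 < y →
      x * (2 : ℝ) ^ 𝒦 ≤ 4 * y →
      SymbolAt (fun t => amplitude n (phase n a) K φ ψ z lam x t) y
        (B * E * y ^ (-μ) * √(hessianSize n c Q y)) := by
  obtain ⟨B1, hB1, h1⟩ := hφ.exists_symbol_bound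
  obtain ⟨B2, hB2, h2⟩ := exists_symbol_bound_slice hψ hψc
  refine ⟨10 * (√((3 * κ) ^ n) * (4 * (1 + ‖z‖) ^ 2 * ((3 * κ) ^ n * (2 * κ) ^ n) ^ 2)) * B1 * B2,
    by positivity, ?_⟩
  intro E 𝒦 r Q s α m c a hH hα hQ K hK lam hlam x y hx hy hxy
  have hxy2 : x ≤ y / 2 := by nlinarith [hα.1]
  have hh := hH.hessianSize_pos hy
  have hL : 0 < lam ^ ((1 : ℝ) / n) := by positivity
  have k1 := hK.symbolAt hμ0 hμ1 hy hxy2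
  have hκ0 : 0 < (2 * κ) ^ n := by positivity
  have hcd : ContDiffAt ℝ 2 (fun t => mixedHessian (phase n a) x t) y := by
    simp only [mixedHessian_phase]
    exact (contDiff_phaseD_right n a 1 1 x).contDiffAt
  have k2 := SymbolAt.abs_cpow (H := fun t => mixedHessian (phase n a) x t)
    (m := hessianSize n c Q y / (2 * κ) ^ n)
    (hH.symbolAt hα hQ hκ hx hy hxy) hcd hy.le
    (by positivity) (by rw [div_le_iff₀' hκ0]; exact hH.hessianSize_le hα hQ hκ hx hy hxy) hz
  have k3 := (((k1.mul k2 hy.le).mul (h1 _ x y hL hy hxy2) hy.le).mul (h2 x y hy) hy.le)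
  refine k3.mono (le_of_eq ?_)
  have e : (3 * κ) ^ n * hessianSize n c Q y / (hessianSize n c Q y / (2 * κ) ^ n) =
      (3 * κ) ^ n * (2 * κ) ^ n := by field_simp
  rw [e, Real.sqrt_mul (by positivity)]
  ring

/-! ### One dyadic piece -/

/-- The kernel `e^{iλS} K |S''|^z [1 - φ((x-y) λ^{1/n})] ψ`, before the dyadic decomposition. -/
noncomputable def baseKernel (n : ℕ) (S : ℝ → ℝ → ℝ) (K : ℝ → ℝ → ℂ) (φ : ℝ → ℝ) (ψ : ℝ × ℝ → ℂ)
    (z : ℂ) (lam x y : ℝ) : ℂ :=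
  Complex.exp (Complex.I * ((lam * S x y : ℝ) : ℂ)) * amplitude n S K φ ψ z lam x y

theorem dampedKernel_eq (n : ℕ) (S : ℝ → ℝ → ℝ) (K : ℝ → ℝ → ℂ) (φ Ψ : ℝ → ℝ) (ψ : ℝ × ℝ → ℂ)
    (z : ℂ) (lam : ℝ) (j k : ℤ) (x y : ℝ) :
    dampedKernel n S K φ Ψ ψ z lam j k x y = baseKernel n S K φ ψ z lam x y *
      ((Ψ ((2 : ℝ) ^ j * x) * Ψ ((2 : ℝ) ^ k * y) : ℝ) : ℂ) := by
  unfold dampedKernel baseKernel amplitude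
  ring

theorem hessianSize_le_two_pow_mul (n : ℕ) (c : ℝ) {r : ℕ} {Q : Fin r → QuadraticForm ℝ (ℝ × ℝ)}
    (hQ : ∀ l, (Q l).PosDef) {u v : ℝ} (hu : 0 ≤ u) (huv : u ≤ 2 * v) :
    hessianSize n c Q u ≤ 2 ^ n * hessianSize n c Q v := by
  have h1 : 0 ≤ ∏ l, Q l (0, 1) := Finset.prod_nonneg fun l _ => (hQ l).nonneg _
  have hv : 0 ≤ v := by linarith
  unfold hessianSize
  calc _ ≤ |c| * (∏ l, Q l (0, 1)) * (2 ^ n * v ^ (n - 2)) := by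
        gcongr
        calc u ^ (n - 2) ≤ (2 * v) ^ (n - 2) := by gcongr
          _ = 2 ^ (n - 2) * v ^ (n - 2) := mul_pow _ _ _
          _ ≤ 2 ^ n * v ^ (n - 2) := by
            gcongr
            · norm_num
            · omega
    _ = _ := by ring

theorem integrable_inv_one_add_mul_sq {q : ℝ} (hq : 0 < q) (W : ℝ) :
    Integrable fun t : ℝ => W * (1 + (q * t) ^ 2)⁻¹ :=
  (integrable_inv_one_add_sq.comp_mul_left' hq.ne').const_mul W

theorem integral_inv_one_add_mul_sq {q : ℝ} (hq : 0 < q) (W : ℝ) :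
    ∫ t : ℝ, W * (1 + (q * t) ^ 2)⁻¹ = W * (Real.pi / q) := by
  rw [integral_const_mul, Measure.integral_comp_mul_left (fun x : ℝ => (1 + x ^ 2)⁻¹) q,
    integral_univ_inv_one_add_sq, abs_of_pos (inv_pos.2 hq), smul_eq_mul]
  ring

set_option maxHeartbeats 1000000 in
/-- The `TT*` kernel of the part of `T_Y^z` living at `y ~ 2^{-k}` is dominated by a convolution kernel
of mass `O(λ⁻¹ 2^{2kμ})`. -/
theorem exists_schur_majorant (n : ℕ) {μ κ E P : ℝ} (hμ0 : 0 < μ) (hμ1 : μ < 1) (hκ : 1 ≤ κ)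
    (hP : 0 ≤ P) {φ Ψ : ℝ → ℝ} (hφ : IsCutoff φ) (hΨ : IsDyadicPartition Ψ) {ψ : ℝ × ℝ → ℂ}
    (hψ : ContDiff ℝ ∞ ψ) (hψc : HasCompactSupport ψ) {z : ℂ} (hz : z.re = 1 / 2) :
    ∃ C, 0 < C ∧ ∀ (𝒦 : ℝ) (r : ℕ) (Q : Fin r → QuadraticForm ℝ (ℝ × ℝ)) (s : ℕ)
      (α : Fin s → ℝ) (m : Fin s → ℕ) (c : ℝ) (a : ℕ → ℝ),
      HessianFactors n (phase n a) c α m Q → DominatesLines 𝒦 α → (∀ l, FormBound 𝒦 κ (Q l)) →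
      ∀ K : ℝ → ℝ → ℂ, IsSingularKernel μ E K → ∀ lam : ℝ, 0 < lam → ∀ (k : ℤ) (χ : ℝ → ℝ),
      (∀ x, |χ x| ≤ P) →
      (∀ x, χ x ≠ 0 → 0 < x ∧ x * (2 : ℝ) ^ 𝒦 ≤ 2 * ((2 : ℝ) ^ k)⁻¹) →
      ∃ w : ℝ → ℝ, Integrable w ∧ (∀ t, w (-t) = w t) ∧
        (∫ t, w t ≤ (C * (lam ^ (-(1 / 2) : ℝ) * ((2 : ℝ) ^ k) ^ μ)) ^ 2) ∧
        ∀ x x', ‖∫ y, baseKernel n (phase n a) K φ ψ z lam x y *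
            ((χ x * Ψ ((2 : ℝ) ^ k * y) : ℝ) : ℂ) *
          (starRingEnd ℂ) (baseKernel n (phase n a) K φ ψ z lam x' y *
            ((χ x' * Ψ ((2 : ℝ) ^ k * y) : ℝ) : ℂ))‖ ≤ w (x - x') := by
  obtain ⟨B, hB0, hB⟩ := exists_amplitude_bound n hμ0 hμ1 hκ hφ hψ hψc hz
  obtain ⟨b, hb0, hb⟩ := hΨ.exists_symbol_bound
  -- The ratio of the upper to the lower bound for the derivative of the phase difference; each
  -- `2^n` accounts for `y` ranging over `[Y/2, 2Y]`.
  set R : ℝ := 3 * (3 * κ) ^ n * 2 ^ n * ((2 * κ) ^ n * 2 ^ n) with hR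
  have hκ0 : 0 < κ := by linarith
  set C0 : ℝ := P ^ 2 * (600 * (B * E * 2 * b) ^ 2 * 2 ^ n * R ^ 4) *
    (Real.pi * ((2 * κ) ^ n * 2 ^ n)) with hC0
  have hC00 : 0 ≤ C0 := by positivity
  refine ⟨√C0 + 1, by positivity, ?_⟩
  intro 𝒦 r Q s α m c a hH hα hQ K hK lam hlam k χ hχP hχ
  have hE := hK.nonneg
  have hk : 0 < (2 : ℝ) ^ k := by positivity
  set Y : ℝ := ((2 : ℝ) ^ k)⁻¹ with hYdef
  have hY : 0 < Y := by positivity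
  set h0 := hessianSize n c Q Y
  have hh0 : 0 < h0 := hH.hessianSize_pos hY
  have hR1 : 1 ≤ R := by
    have e1 : 1 ≤ (3 * κ) ^ n := one_le_pow₀ (by linarith)
    have e2 : (1 : ℝ) ≤ 2 ^ n := one_le_pow₀ (by norm_num)
    have e3 : 1 ≤ (2 * κ) ^ n := one_le_pow₀ (by linarith)
    calc (1 : ℝ) ≤ 3 * 1 * 1 * (1 * 1) := by norm_num
      _ ≤ _ := by rw [hR]; gcongr
  set A : ℝ := (B * E * 2 * b) ^ 2 * 2 ^ n * h0 * (Y ^ (-μ)) ^ 2 with hA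
  set q : ℝ := lam * h0 * Y / ((2 * κ) ^ n * 2 ^ n) with hq
  have hq0 : 0 < q := by positivity
  set W : ℝ := P ^ 2 * (600 * A * R ^ 4 * Y) with hW
  have hW0 : 0 ≤ W := by positivity
  refine ⟨fun t => W * (1 + (q * t) ^ 2)⁻¹, integrable_inv_one_add_mul_sq hq0 W,
    fun t => by simp only [mul_neg, neg_sq], ?_, fun x x' => ?_⟩
  · rw [integral_inv_one_add_mul_sq hq0]
    -- Here the damping acts: `W` contains one factor `h0` from the two square roots, `q` contains
    -- one from the phase, and they cancel together with `Y`.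
    have e1 : W * (Real.pi / q) = C0 * (lam⁻¹ * (Y ^ (-μ)) ^ 2) := by
      rw [hW, hA, hq, hC0]
      field_simp
    have e2 : Y ^ (-μ) = ((2 : ℝ) ^ k) ^ μ := by
      rw [hYdef, Real.inv_rpow hk.le, Real.rpow_neg hk.le, inv_inv]
    have e3 : (lam ^ (-(1 / 2) : ℝ)) ^ 2 = lam⁻¹ := by
      rw [← Real.rpow_natCast, ← Real.rpow_mul hlam.le]
      norm_num
      exact Real.rpow_neg_one lam
    rw [e1, e2, mul_pow, mul_pow, e3]
    gcongr
    nlinarith [Real.sq_sqrt hC00, Real.sqrt_nonneg C0]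
  · by_cases h1 : χ x = 0
    · simp only [h1, zero_mul, Complex.ofReal_zero, mul_zero, integral_zero, norm_zero]
      positivity
    by_cases h2 : χ x' = 0
    · simp only [h2, zero_mul, Complex.ofReal_zero, mul_zero, map_zero, integral_zero, norm_zero]
      positivity
    obtain ⟨hx, hx𝒦⟩ := hχ x h1
    obtain ⟨hx', hx𝒦'⟩ := hχ x' h2
    have hP𝒦 : 0 < (2 : ℝ) ^ 𝒦 := by positivity
    -- The mean value arguments need the whole segment between `x'` and `x` in the sector. The
    -- constant `2` at `Y` becomes `4` at `y` because `y ≥ Y/2`.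
    have hsec : ∀ t ∈ Set.uIcc x' x, ∀ y ∈ Set.Icc (Y / 2) (2 * Y),
        0 ≤ t ∧ t * (2 : ℝ) ^ 𝒦 ≤ 4 * y := by
      intro t ht y hy
      have h3 : t ≤ max x' x := ht.2
      have h4 : min x' x ≤ t := ht.1
      have h5 : t * (2 : ℝ) ^ 𝒦 ≤ 2 * Y := by
        rcases le_total x' x with h | h
        · rw [max_eq_right h] at h3
          exact (mul_le_mul_of_nonneg_right h3 hP𝒦.le).trans hx𝒦
        · rw [max_eq_left h] at h3
          exact (mul_le_mul_of_nonneg_right h3 hP𝒦.le).trans hx𝒦'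
      exact ⟨(lt_min hx' hx).le.trans h4, by linarith [hy.1]⟩
    have hypos : ∀ y ∈ Set.Icc (Y / 2) (2 * Y), 0 < y := fun y hy => by linarith [hy.1]
    have hsup : ∀ y ∈ Set.Icc (Y / 2) (2 * Y), hessianSize n c Q y ≤ 2 ^ n * h0 := fun y hy =>
      hessianSize_le_two_pow_mul n c hH.posDef (hypos y hy).le hy.2
    have hinf : ∀ y ∈ Set.Icc (Y / 2) (2 * Y), h0 ≤ 2 ^ n * hessianSize n c Q y := fun y hy =>
      hessianSize_le_two_pow_mul n c hH.posDef hY.le (by linarith [hy.1])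
    set D := lam * |x - x'| with hD
    have hD0 : 0 ≤ D := by positivity
    set g : ℝ → ℝ := fun y => lam * (phaseD n a 0 0 x y - phaseD n a 0 0 x' y) with hg
    set p : ℝ → ℝ := fun y => lam * (phaseD n a 0 1 x y - phaseD n a 0 1 x' y) with hp
    set A1 : ℝ → ℝ → ℂ := fun u y =>
      amplitude n (phase n a) K φ ψ z lam u y * ((Ψ ((2 : ℝ) ^ k * y) : ℝ) : ℂ) with hA1
    set a' : ℝ → ℂ := fun y => A1 x y * (starRingEnd ℂ) (A1 x' y) with ha'
    have hA1s : ∀ u ∈ Set.uIcc x' x, ∀ y ∈ Set.Icc (Y / 2) (2 * Y),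
        SymbolAt (A1 u) y (B * E * (2 * Y ^ (-μ)) * √(2 ^ n * h0) * b) := by
      intro u hu y hy
      have hy0 := hypos y hy
      obtain ⟨hu0, hu𝒦⟩ := hsec u hu y hy
      have k1 := (hB E 𝒦 r Q s α m c a hH hα hQ K hK lam hlam u y hu0 hy0 hu𝒦).mul
        (hb _ y hk hy0) hy0.le
      refine k1.mono ?_
      have e1 : y ^ (-μ) ≤ 2 * Y ^ (-μ) := by
        calc y ^ (-μ) ≤ (Y / 2) ^ (-μ) :=
              Real.rpow_le_rpow_of_nonpos (by positivity) hy.1 (by linarith)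
          _ = 2 ^ μ * Y ^ (-μ) := by
              rw [Real.div_rpow hY.le (by norm_num), Real.rpow_neg (by norm_num : (0 : ℝ) ≤ 2)]
              field_simp
          _ ≤ 2 ^ (1 : ℝ) * Y ^ (-μ) := by
              gcongr
              norm_num
          _ = _ := by rw [Real.rpow_one]
      gcongr
      exact hsup y hy
    have hux : x ∈ Set.uIcc x' x := Set.right_mem_uIcc
    have hux' : x' ∈ Set.uIcc x' x := Set.left_mem_uIcc
    have ha's : ∀ y ∈ Set.Icc (Y / 2) (2 * Y), SymbolAt a' y A := by
      intro y hy
      refine ((hA1s x hux y hy).mul (hA1s x' hux' y hy).conj (hypos y hy).le).mono (le_of_eq ?_)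
      have e := Real.mul_self_sqrt (by positivity : 0 ≤ 2 ^ n * h0)
      calc _ = (B * E * 2 * b) ^ 2 * (√(2 ^ n * h0) * √(2 ^ n * h0)) * (Y ^ (-μ)) ^ 2 := by ring
        _ = _ := by rw [e, hA]; ring
    -- Both factors of `a'` carry `Ψ(2^k y)`, so a zero of `Ψ` is a double zero of `a'`, and nothing
    -- has to be known about `Ψ'`.
    have hend : ∀ y, Ψ ((2 : ℝ) ^ k * y) = 0 → y ∈ Set.Icc (Y / 2) (2 * Y) →
        a' y = 0 ∧ deriv a' y = 0 := by
      intro y h0' hy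
      have z1 : ∀ u, A1 u y = 0 := fun u => by simp [hA1, h0']
      refine ⟨by simp [ha', z1], ?_⟩
      have d1 := (hA1s x hux y hy).contDiffAt.eventually_hasDerivAt_of_two.self_of_nhds
      have d2 :=
        (hA1s x' hux' y hy).conj.contDiffAt.eventually_hasDerivAt_of_two.self_of_nhds
      have := (d1.mul d2).deriv
      rw [z1, z1, map_zero, mul_zero, zero_mul, add_zero] at this
      exact this
    have hle : Y / 2 ≤ 2 * Y := by linarith
    have hkY : (2 : ℝ) ^ k * Y = 1 := mul_inv_cancel₀ hk.ne'
    have hl := hend (Y / 2) (by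
      rw [← mul_div_assoc, hkY]; exact hΨ.eq_zero_half) ⟨le_rfl, hle⟩
    have hr := hend (2 * Y) (by
      rw [mul_left_comm, hkY, mul_one]; exact hΨ.eq_zero_two) ⟨hle, le_rfl⟩
    have hsupp : ∀ y, y ∉ Set.Icc (Y / 2) (2 * Y) → a' y = 0 := by
      intro y hy
      have : Ψ ((2 : ℝ) ^ k * y) = 0 := by
        refine hΨ.eq_zero fun h => hy ?_
        have e : y = Y * ((2 : ℝ) ^ k * y) := by rw [← mul_assoc, mul_comm Y, hkY, one_mul]
        rw [e]
        constructor
        · nlinarith [h.1]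
        · nlinarith [h.2]
      simp [ha', hA1, this]
    have key := norm_integral_exp_mul_le (g := g) (p := p) (a := a')
      (m := D * (h0 / ((2 * κ) ^ n * 2 ^ n))) hY (by positivity) hR1
      (fun y => ((hasDerivAt_phaseD_right n a 0 0 x y).sub
        (hasDerivAt_phaseD_right n a 0 0 x' y)).const_mul lam)
      (contDiff_const.mul ((contDiff_phaseD_right n a 0 1 x).sub
        (contDiff_phaseD_right n a 0 1 x')))
      (fun y hy => (symbolAt_phase_difference n a hlam.le (hypos y hy)
        (fun t ht => (hH.symbolAt hα hQ hκ (hsec t ht y hy).1 (hypos y hy)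
          (hsec t ht y hy).2).mono (mul_le_mul_of_nonneg_left (hsup y hy) (by positivity)))).mono
        (le_of_eq (by rw [hR]; field_simp; exact hD.symm)))
      (fun y hy => le_abs_phase_difference n a hlam.le (fun t ht => by
        rw [div_le_iff₀ (by positivity)]
        refine (hinf y hy).trans ?_
        have := hH.hessianSize_le hα hQ hκ (hsec t ht y hy).1 (hypos y hy) (hsec t ht y hy).2
        calc _ ≤ 2 ^ n * ((2 * κ) ^ n * |mixedHessian (phase n a) t y|) := by gcongr
          _ = _ := by ring))
      ha's hsupp hl.1 hr.1 hl.2 hr.2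
    -- The factors `χ` depend on `x` and `x'` alone and leave the integral; hence `χ` has to be
    -- bounded but not smooth.
    have hfac : ∀ y, baseKernel n (phase n a) K φ ψ z lam x y *
            ((χ x * Ψ ((2 : ℝ) ^ k * y) : ℝ) : ℂ) *
          (starRingEnd ℂ) (baseKernel n (phase n a) K φ ψ z lam x' y *
            ((χ x' * Ψ ((2 : ℝ) ^ k * y) : ℝ) : ℂ)) =
        ((χ x * χ x' : ℝ) : ℂ) * (Complex.exp (Complex.I * (g y : ℂ)) * a' y) := by
      intro y
      have e : Complex.exp (Complex.I * (g y : ℂ)) =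
          Complex.exp (Complex.I * ((lam * phase n a x y : ℝ) : ℂ)) *
          (starRingEnd ℂ) (Complex.exp (Complex.I * ((lam * phase n a x' y : ℝ) : ℂ))) := by
        rw [← Complex.exp_conj, ← Complex.exp_add]
        congr 1
        simp only [hg, phaseD_zero_zero, map_mul, Complex.conj_I, Complex.conj_ofReal]
        push_cast
        ring
      rw [e]
      simp only [ha', hA1, baseKernel, map_mul, Complex.conj_ofReal]
      push_cast
      ring
    simp only [hfac]
    rw [integral_const_mul, norm_mul, Complex.norm_real, Real.norm_eq_abs, abs_mul]
    calc _ ≤ P * P * (600 * A * R ^ 4 * Y / (1 + (D * (h0 / ((2 * κ) ^ n * 2 ^ n)) * Y) ^ 2)) := by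
          gcongr
          · exact hχP x
          · exact hχP x'
      _ = _ := by
          have : (D * (h0 / ((2 * κ) ^ n * 2 ^ n)) * Y) ^ 2 = (q * (x - x')) ^ 2 := by
            rw [hq, hD, mul_pow (_ / _) (x - x'), ← sq_abs (x - x'), ← mul_pow]
            ring
          rw [this, hW]
          ring

/-! ### Dyadic sums -/

theorem IsDyadicPartition.pos_of_ne {Ψ : ℝ → ℝ} (hΨ : IsDyadicPartition Ψ) {j : ℤ} {t : ℝ}
    (h : Ψ ((2 : ℝ) ^ j * t) ≠ 0) : 0 < t ∧ 1 / 2 ≤ (2 : ℝ) ^ j * t ∧ (2 : ℝ) ^ j * t ≤ 2 := by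
  have h1 : (2 : ℝ) ^ j * t ∈ Set.Icc (1 / 2 : ℝ) 2 := by
    by_contra h0
    exact h (hΨ.eq_zero h0)
  have h2 : 0 < (2 : ℝ) ^ j := by positivity
  exact ⟨pos_of_mul_pos_right (lt_of_lt_of_le (by norm_num) h1.1) h2.le, h1.1, h1.2⟩

/-- The condition `1/2 ≤ 2^j t ≤ 2` confines `2^j` to a closed interval of ratio four, which holds
at most three powers of two. -/
theorem IsDyadicPartition.exists_Icc {Ψ : ℝ → ℝ} (hΨ : IsDyadicPartition Ψ) (t : ℝ) :
    ∃ j₀ : ℤ, ∀ j : ℤ, Ψ ((2 : ℝ) ^ j * t) ≠ 0 → j ∈ Finset.Icc j₀ (j₀ + 2) := by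
  rcases le_or_gt t 0 with ht | ht
  · exact ⟨0, fun j hj => absurd (hΨ.pos_of_ne hj).1 (not_lt.2 ht)⟩
  · obtain ⟨j₀, h1, h2⟩ := exists_mem_Ico_zpow (x := 1 / (2 * t)) (y := (2 : ℝ)) (by positivity)
      (by norm_num)
    refine ⟨j₀, fun j hj => ?_⟩
    obtain ⟨-, h3, h4⟩ := hΨ.pos_of_ne hj
    rw [Finset.mem_Icc]
    constructor
    · have : (2 : ℝ) ^ j₀ ≤ (2 : ℝ) ^ j := by
        refine h1.trans ?_
        rw [div_le_iff₀ (by positivity)]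
        linarith
      exact (zpow_le_zpow_iff_right₀ (by norm_num : (1 : ℝ) < 2)).1 this
    · have : (2 : ℝ) ^ j < (2 : ℝ) ^ (j₀ + 3) := by
        have e : (2 : ℝ) ^ (j₀ + 3) = 4 * (2 : ℝ) ^ (j₀ + 1) := by
          rw [show j₀ + 3 = (j₀ + 1) + 2 by ring, zpow_add₀ (by norm_num : (2 : ℝ) ≠ 0) (j₀ + 1)]
          norm_num; ring
        rw [e]
        rw [div_lt_iff₀ (by positivity)] at h2
        nlinarith
      have := (zpow_lt_zpow_iff_right₀ (by norm_num : (1 : ℝ) < 2)).1 this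
      omega

theorem Int.card_Icc_add_two (j : ℤ) : (Finset.Icc j (j + 2)).card = 3 := by
  rw [Int.card_Icc]
  omega

theorem IsDyadicPartition.exists_bound {Ψ : ℝ → ℝ} (hΨ : IsDyadicPartition Ψ) :
    ∃ B, 0 ≤ B ∧ ∀ t, |Ψ t| ≤ B := by
  obtain ⟨B, hB⟩ := hΨ.hasCompactSupport.exists_bound_of_continuous hΨ.smooth.continuous
  exact ⟨B, (norm_nonneg _).trans (hB 0), hB⟩

/-- The sum of `Ψ(2^j x)` over `j ≫ k`. -/
noncomputable def dyadicTail (Ψ : ℝ → ℝ) (𝒦 : ℝ) (k : ℤ) (x : ℝ) : ℝ :=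
  ∑' j : ℤ, if (j : ℝ) > k + 𝒦 then Ψ ((2 : ℝ) ^ j * x) else 0

theorem hasSum_dyadicTail {Ψ : ℝ → ℝ} (𝒦 : ℝ)
    (k : ℤ) {x : ℝ} {I : Finset ℤ} (hI : ∀ j : ℤ, Ψ ((2 : ℝ) ^ j * x) ≠ 0 → j ∈ I) :
    HasSum (fun j : ℤ => if (j : ℝ) > k + 𝒦 then Ψ ((2 : ℝ) ^ j * x) else 0)
      (∑ j ∈ I, if (j : ℝ) > k + 𝒦 then Ψ ((2 : ℝ) ^ j * x) else 0) :=
  hasSum_sum_of_ne_finset_zero fun j hj => by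
    have : Ψ ((2 : ℝ) ^ j * x) = 0 := by
      by_contra h
      exact hj (hI j h)
    simp [this]

theorem dyadicTail_eq {Ψ : ℝ → ℝ} (𝒦 : ℝ)
    (k : ℤ) {x : ℝ} {I : Finset ℤ} (hI : ∀ j : ℤ, Ψ ((2 : ℝ) ^ j * x) ≠ 0 → j ∈ I) :
    dyadicTail Ψ 𝒦 k x = ∑ j ∈ I, if (j : ℝ) > k + 𝒦 then Ψ ((2 : ℝ) ^ j * x) else 0 :=
  (hasSum_dyadicTail 𝒦 k hI).tsum_eq

theorem IsDyadicPartition.abs_dyadicTail_le {Ψ : ℝ → ℝ} (hΨ : IsDyadicPartition Ψ) {B : ℝ}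
    (hB : ∀ t, |Ψ t| ≤ B) (𝒦 : ℝ) (k : ℤ) (x : ℝ) : |dyadicTail Ψ 𝒦 k x| ≤ 3 * B := by
  obtain ⟨j₀, hj⟩ := hΨ.exists_Icc x
  have hB0 : 0 ≤ B := (abs_nonneg _).trans (hB 0)
  rw [dyadicTail_eq 𝒦 k hj]
  refine (Finset.abs_sum_le_sum_abs _ _).trans ?_
  refine (Finset.sum_le_card_nsmul _ _ B fun j _ => ?_).trans (le_of_eq ?_)
  · split_ifs
    · exact hB _
    · simpa using hB0
  · rw [Int.card_Icc_add_two, nsmul_eq_mul, Nat.cast_ofNat]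

theorem measurable_dyadicTail {Ψ : ℝ → ℝ} (hΨ : IsDyadicPartition Ψ) (𝒦 : ℝ) (k : ℤ) :
    Measurable (dyadicTail Ψ 𝒦 k) := by
  refine measurable_of_tendsto_metrizable' (atTop : Filter (Finset ℤ))
    (f := fun (s : Finset ℤ) x => ∑ j ∈ s, if (j : ℝ) > k + 𝒦 then Ψ ((2 : ℝ) ^ j * x) else 0) (fun s => ?_) ?_
  · refine Finset.measurable_fun_sum _ fun j _ => ?_
    have := hΨ.smooth.continuous
    split_ifs
    · exact (this.comp (continuous_const.mul continuous_id)).measurable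
    · exact measurable_const
  · rw [tendsto_pi_nhds]
    intro x
    obtain ⟨j₀, hj⟩ := hΨ.exists_Icc x
    have := hasSum_dyadicTail 𝒦 k hj
    rw [← dyadicTail_eq 𝒦 k hj] at this
    exact this

/-- Some `j > k + 𝒦` has `2^j x ≤ 2`, and `2^j ≥ 2^k 2^𝒦`. This is how the index condition `j ≫ k`
becomes the sector on which the Hessian is controlled. -/
theorem IsDyadicPartition.dyadicTail_ne {Ψ : ℝ → ℝ} (hΨ : IsDyadicPartition Ψ) {𝒦 : ℝ} {k : ℤ}
    {x : ℝ} (h : dyadicTail Ψ 𝒦 k x ≠ 0) :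
    0 < x ∧ x * (2 : ℝ) ^ 𝒦 ≤ 2 * ((2 : ℝ) ^ k)⁻¹ := by
  obtain ⟨j, hj⟩ : ∃ j : ℤ, (if (j : ℝ) > k + 𝒦 then Ψ ((2 : ℝ) ^ j * x) else 0) ≠ 0 := by
    by_contra! h0
    exact h (by unfold dyadicTail; simp only [h0, tsum_zero])
  split_ifs at hj with h1
  · obtain ⟨hx, -, h2⟩ := hΨ.pos_of_ne hj
    refine ⟨hx, ?_⟩
    have hk : 0 < (2 : ℝ) ^ k := by positivity
    rw [← div_eq_mul_inv, le_div_iff₀ hk]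
    have e : (2 : ℝ) ^ k * (2 : ℝ) ^ 𝒦 ≤ (2 : ℝ) ^ j := by
      rw [← Real.rpow_intCast, ← Real.rpow_intCast, ← Real.rpow_add (by norm_num)]
      exact Real.rpow_le_rpow_of_exponent_le (by norm_num) h1.le
    nlinarith
  · exact absurd rfl hj

/-- The double sum is regrouped by `k`. Any finite `I` that contains the active `k` is allowed, so
that a single `I` can later serve all points of the support of the kernel. -/
theorem IsDyadicPartition.hasSum_indexY {Ψ : ℝ → ℝ} (hΨ : IsDyadicPartition Ψ) (𝒦 x y : ℝ)
    {I : Finset ℤ}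
    (hI : ∀ k, dyadicTail Ψ 𝒦 k x ≠ 0 → Ψ ((2 : ℝ) ^ k * y) ≠ 0 → k ∈ I) :
    HasSum (fun p : indexY 𝒦 => Ψ ((2 : ℝ) ^ p.1.1 * x) * Ψ ((2 : ℝ) ^ p.1.2 * y))
      (∑ k ∈ I, dyadicTail Ψ 𝒦 k x * Ψ ((2 : ℝ) ^ k * y)) := by
  classical
  obtain ⟨j₀, hj⟩ := hΨ.exists_Icc x
  obtain ⟨k₀, hk⟩ := hΨ.exists_Icc y
  have h1 : ∑ k ∈ I, dyadicTail Ψ 𝒦 k x * Ψ ((2 : ℝ) ^ k * y) =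
      ∑ k ∈ Finset.Icc k₀ (k₀ + 2), dyadicTail Ψ 𝒦 k x * Ψ ((2 : ℝ) ^ k * y) := by
    rw [← tsum_eq_sum (s := I) (L := .unconditional ℤ) (f := fun k => dyadicTail Ψ 𝒦 k x * Ψ ((2 : ℝ) ^ k * y)),
      ← tsum_eq_sum (s := Finset.Icc k₀ (k₀ + 2)) (L := .unconditional ℤ)
        (f := fun k => dyadicTail Ψ 𝒦 k x * Ψ ((2 : ℝ) ^ k * y))]
    · intro k hk'
      by_contra h
      exact hk' (hk k (right_ne_zero_of_mul h))
    · intro k hk'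
      by_contra h
      exact hk' (hI k (left_ne_zero_of_mul h) (right_ne_zero_of_mul h))
  have h2 : ∑ k ∈ Finset.Icc k₀ (k₀ + 2), dyadicTail Ψ 𝒦 k x * Ψ ((2 : ℝ) ^ k * y) =
      ∑ p ∈ Finset.Icc j₀ (j₀ + 2) ×ˢ Finset.Icc k₀ (k₀ + 2),
        (indexY 𝒦).indicator (fun p => Ψ ((2 : ℝ) ^ p.1 * x) * Ψ ((2 : ℝ) ^ p.2 * y)) p := by
    rw [Finset.sum_product_right]
    refine Finset.sum_congr rfl fun k _ => ?_
    rw [dyadicTail_eq 𝒦 k hj, Finset.sum_mul]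
    refine Finset.sum_congr rfl fun j _ => ?_
    rw [Set.indicator_apply, ite_mul, zero_mul]
    rfl
  rw [h1, h2]
  refine (hasSum_subtype_iff_indicator
    (f := fun p : ℤ × ℤ => Ψ ((2 : ℝ) ^ p.1 * x) * Ψ ((2 : ℝ) ^ p.2 * y))).2
    (hasSum_sum_of_ne_finset_zero fun p hp => ?_)
  refine Set.indicator_apply_eq_zero.2 fun _ => ?_
  by_contra h
  exact hp (Finset.mem_product.2 ⟨hj _ (left_ne_zero_of_mul h), hk _ (right_ne_zero_of_mul h)⟩)

theorem IsDyadicPartition.hasSum_indexX {Ψ : ℝ → ℝ} (hΨ : IsDyadicPartition Ψ) (𝒦 x y : ℝ)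
    {I : Finset ℤ}
    (hI : ∀ j, dyadicTail Ψ 𝒦 j y ≠ 0 → Ψ ((2 : ℝ) ^ j * x) ≠ 0 → j ∈ I) :
    HasSum (fun p : indexX 𝒦 => Ψ ((2 : ℝ) ^ p.1.1 * x) * Ψ ((2 : ℝ) ^ p.1.2 * y))
      (∑ j ∈ I, dyadicTail Ψ 𝒦 j y * Ψ ((2 : ℝ) ^ j * x)) := by
  have hmem : ∀ p : ℤ × ℤ, p ∈ indexX 𝒦 ↔ Equiv.prodComm ℤ ℤ p ∈ indexY 𝒦 := fun p => by
    simp only [indexX, indexY, Set.mem_ofPred_eq, Equiv.prodComm_apply, Prod.fst_swap,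
      Prod.snd_swap, gt_iff_lt]
    exact lt_sub_iff_add_lt
  have h := (Equiv.hasSum_iff ((Equiv.prodComm ℤ ℤ).subtypeEquiv hmem)).2
    (hΨ.hasSum_indexY 𝒦 y x hI)
  convert h using 2 with p
  exact mul_comm _ _

/-- The bound does not involve `k₀`: the largest term dominates, so the lower end of the range of
frequencies, which depends on `ψ`, never enters the estimate. -/
theorem sum_Icc_zpow_le {r : ℝ} (hr : 1 < r) (k₀ k₁ : ℤ) :
    ∑ k ∈ Finset.Icc k₀ k₁, r ^ k ≤ r / (r - 1) * r ^ k₁ := by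
  have hr0 : 0 < r := by linarith
  have key : ∀ N : ℕ, (r - 1) * ∑ k ∈ Finset.Icc (k₁ - N) k₁, r ^ k = r * r ^ k₁ - r ^ (k₁ - N) := by
    intro N
    induction N with
    | zero => simp; ring
    | succ N ih =>
      have e : Finset.Icc (k₁ - (N + 1 : ℕ)) k₁ =
          insert (k₁ - (N + 1 : ℕ)) (Finset.Icc (k₁ - N) k₁) := by
        ext k
        simp only [Finset.mem_Icc, Finset.mem_insert]
        push_cast
        omega
      have e2 : r ^ (k₁ - (N : ℤ)) = r * r ^ (k₁ - ((N + 1 : ℕ) : ℤ)) := by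
        rw [← zpow_one_add₀ hr0.ne']
        congr 1
        push_cast
        ring
      rw [e, Finset.sum_insert (by rw [Finset.mem_Icc]; push_cast; omega), mul_add, ih, e2]
      ring
  rcases le_or_gt k₀ k₁ with h | h
  · have h1 := key (k₁ - k₀).toNat
    rw [Int.toNat_of_nonneg (by omega), sub_sub_cancel] at h1
    rw [div_mul_eq_mul_div, le_div_iff₀ (by linarith), mul_comm, h1]
    have : 0 < r ^ k₀ := by positivity
    linarith
  · rw [Finset.Icc_eq_empty (by omega), Finset.sum_empty]
    have : 0 < r - 1 := by linarith
    positivity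

/-! ### Reassembling the operator -/

/-- Summation of a dyadic decomposition whose pieces are regrouped into finitely many operators
with known norm bounds. -/
theorem hasL2Bound_of_hasSum {J : Set (ℤ × ℤ)} {ker : ℤ → ℤ → ℝ → ℝ → ℂ} {b : ℝ × ℝ → ℂ}
    {M M' R : ℝ} (hb : IsBoxKernel b M R) {Ψ : ℝ → ℝ} (hΨ : IsDyadicPartition Ψ)
    (hker : ∀ j k x y, ker j k x y =
      b (x, y) * ((Ψ ((2 : ℝ) ^ j * x) * Ψ ((2 : ℝ) ^ k * y) : ℝ) : ℂ))
    (I : Finset ℤ) {κ : ℤ → ℝ × ℝ → ℂ} (hκ : ∀ k, IsBoxKernel (κ k) M' R)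
    (hsum : ∀ x y, HasSum (fun p : J => ker p.1.1 p.1.2 x y) (∑ k ∈ I, κ k (x, y)))
    {D : ℤ → ℝ} (hD : ∀ k, 0 ≤ D k)
    (hL : ∀ k ∈ I, ∀ f : ℝ → ℂ, MemLp f 2 volume →
      eLpNorm (fun x => ∫ y, κ k (x, y) * f y) 2 volume ≤
        ENNReal.ofReal (D k) * eLpNorm f 2 volume)
    {B : ℝ} (hB : ∑ k ∈ I, D k ≤ B) : HasL2Bound J ker B := by
  intro f hf
  obtain ⟨P, hP0, hP⟩ := hΨ.exists_bound
  have hΨc := hΨ.smooth.continuous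
  set G : ℝ → ℝ := fun y => M * (Set.Icc (-R) R).indicator (fun y => ‖f y‖) y with hG
  have hGi : Integrable G volume := (IsBoxKernel.integrable_indicator hf R).const_mul M
  have hG0 : ∀ y, 0 ≤ G y := fun y =>
    mul_nonneg hb.nonneg (Set.indicator_nonneg (fun _ _ => norm_nonneg _) _)
  have hle : ∀ (p : ℤ × ℤ) x y, ‖ker p.1 p.2 x y * f y‖ ≤
      |Ψ ((2 : ℝ) ^ p.1 * x)| * |Ψ ((2 : ℝ) ^ p.2 * y)| * G y := by
    intro p x y
    rw [hker, mul_right_comm, norm_mul, Complex.norm_real, Real.norm_eq_abs, abs_mul, mul_comm]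
    gcongr
    exact hb.norm_mul_le f x y
  have hint : ∀ (p : ℤ × ℤ) x, Integrable (fun y => ker p.1 p.2 x y * f y) volume := by
    intro p x
    have hc : Continuous fun y => ((Ψ ((2 : ℝ) ^ p.1 * x) * Ψ ((2 : ℝ) ^ p.2 * y) : ℝ) : ℂ) := by
      fun_prop
    refine (hGi.const_mul (P * P)).mono' ?_ (Eventually.of_forall fun y => (hle p x y).trans ?_)
    · simp only [hker]
      exact ((hb.aestronglyMeasurable_slice x).mul hc.aestronglyMeasurable).mul hf.1
    · have := hG0 y
      gcongr
      · exact hP _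
      · exact hP _
  have hsummable : ∀ x, Summable fun p : ℤ × ℤ => ∫ y, ‖ker p.1 p.2 x y * f y‖ := by
    intro x
    obtain ⟨j₀, hj⟩ := hΨ.exists_Icc x
    -- For given `x` and `y` at most `3 · 3 = 9` pairs `(j, k)` are active, so every finite partial
    -- sum has the same integrable majorant.
    refine summable_of_sum_le (c := ∫ y, 9 * (P * P) * G y)
      (fun p => integral_nonneg fun y => norm_nonneg _) fun u => ?_
    rw [← integral_finsetSum _ fun p _ => (hint p x).norm]
    refine integral_mono (integrable_finsetSum _ fun p _ => (hint p x).norm)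
      (hGi.const_mul _) fun y => ?_
    refine (Finset.sum_le_sum fun p _ => hle p x y).trans ?_
    rw [← Finset.sum_mul]
    refine mul_le_mul_of_nonneg_right ?_ (hG0 y)
    obtain ⟨k₀, hk⟩ := hΨ.exists_Icc y
    have hs : Summable fun p : ℤ × ℤ => |Ψ ((2 : ℝ) ^ p.1 * x)| * |Ψ ((2 : ℝ) ^ p.2 * y)| := by
      refine summable_of_ne_finset_zero (s := Finset.Icc j₀ (j₀ + 2) ×ˢ Finset.Icc k₀ (k₀ + 2)) ?_
      intro p hp
      by_contra h
      exact hp (Finset.mem_product.2 ⟨hj _ (abs_ne_zero.1 (left_ne_zero_of_mul h)),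
        hk _ (abs_ne_zero.1 (right_ne_zero_of_mul h))⟩)
    refine (hs.sum_le_tsum u fun p _ => by positivity).trans ?_
    rw [tsum_eq_sum (s := Finset.Icc j₀ (j₀ + 2) ×ˢ Finset.Icc k₀ (k₀ + 2))]
    · refine (Finset.sum_le_card_nsmul _ _ (P * P) fun p _ => ?_).trans (le_of_eq ?_)
      · exact mul_le_mul (hP _) (hP _) (abs_nonneg _) hP0
      · rw [Finset.card_product, Int.card_Icc_add_two, Int.card_Icc_add_two, nsmul_eq_mul]
        norm_num
    · intro p hp
      by_contra h
      exact hp (Finset.mem_product.2 ⟨hj _ (abs_ne_zero.1 (left_ne_zero_of_mul h)),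
        hk _ (abs_ne_zero.1 (right_ne_zero_of_mul h))⟩)
  have hHS : ∀ x, HasSum (fun p : J => ∫ y, ker p.1.1 p.1.2 x y * f y)
      (∑ k ∈ I, ∫ y, κ k (x, y) * f y) := by
    intro x
    have h1 := hasSum_integral_of_summable_integral_norm
      (F := fun (p : J) y => ker p.1.1 p.1.2 x y * f y) (fun p => hint p.1 x)
      ((hsummable x).comp_injective Subtype.val_injective)
    have h2 : ∫ y, ∑' p : J, ker p.1.1 p.1.2 x y * f y = ∑ k ∈ I, ∫ y, κ k (x, y) * f y := by
      rw [← integral_finsetSum _ fun k _ => (hκ k).integrable_mul hf x]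
      refine integral_congr_ae (Eventually.of_forall fun y => ?_)
      simp only
      rw [((hsum x y).mul_right (f y)).tsum_eq, Finset.sum_mul]
    rwa [h2] at h1
  have hop : sumOperator J ker f = ∑ k ∈ I, fun x => ∫ y, κ k (x, y) * f y := by
    funext x
    rw [sumOperator, (hHS x).tsum_eq, Finset.sum_apply]
  have hmem : ∀ k ∈ I, MemLp (fun x => ∫ y, κ k (x, y) * f y) 2 volume := fun k _ =>
    (hκ k).memLp hf
  refine ⟨fun p _ x => hint p x, fun x => (hHS x).summable, ?_, ?_⟩
  · rw [hop]
    exact memLp_finsetSum' I hmem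
  · rw [hop]
    refine (eLpNorm_sum_le (fun k hk => (hmem k hk).1) one_le_two).trans ?_
    refine (Finset.sum_le_sum fun k hk => hL k hk f hf).trans ?_
    rw [← Finset.sum_mul, ← ENNReal.ofReal_sum_of_nonneg fun k _ => hD k]
    gcongr

theorem IsSingularKernel.swap {μ E : ℝ} {K : ℝ → ℝ → ℂ} (hK : IsSingularKernel μ E K) :
    IsSingularKernel μ E fun x y => K y x where
  contDiffOn := hK.contDiffOn.comp (f := fun p : ℝ × ℝ => (p.2, p.1))
    (contDiff_snd.prodMk contDiff_fst).contDiffOn fun _ hp => Ne.symm hp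
  bound x y h := by rw [abs_sub_comm]; exact hK.bound y x h.symm
  bound_y i hi x y h := by rw [abs_sub_comm]; exact hK.bound_x i hi y x h.symm
  bound_x i hi x y h := by rw [abs_sub_comm]; exact hK.bound_y i hi y x h.symm

theorem IsCutoff.comp_neg {φ : ℝ → ℝ} (hφ : IsCutoff φ) : IsCutoff fun t => φ (-t) where
  smooth := hφ.smooth.comp contDiff_neg
  eq_zero t ht := hφ.eq_zero _ (by rwa [abs_neg])
  eq_one t ht := hφ.eq_one _ (by rwa [abs_neg])

/-- It transfers the bounds for `T_Y` to `T_X`. The cut-off becomes `φ(-t)` because `x - y` changes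
sign, and `φ` is not assumed even. -/
theorem baseKernel_swap (n : ℕ) (a : ℕ → ℝ) (K : ℝ → ℝ → ℂ) (φ : ℝ → ℝ) (ψ : ℝ × ℝ → ℂ) (z : ℂ)
    (lam x y : ℝ) :
    baseKernel n (phase n a) K φ ψ z lam x y =
      baseKernel n (phase n fun k => a (n - k)) (fun u v => K v u) (fun t => φ (-t))
        (fun p => ψ (p.2, p.1)) z lam y x := by
  unfold baseKernel amplitude
  rw [phase_swap, mixedHessian_phase_swap]
  simp only
  rw [← neg_mul, neg_sub]

theorem exists_support_radius {ψ : ℝ × ℝ → ℂ} (hψc : HasCompactSupport ψ) :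
    ∃ R, 0 < R ∧ ∀ x y, ψ (x, y) ≠ 0 → x ∈ Set.Icc (-R) R ∧ y ∈ Set.Icc (-R) R := by
  obtain ⟨R, hR0, hR⟩ := hψc.isCompact.isBounded.subset_closedBall_lt 0 0
  refine ⟨R, hR0, fun x y h => ?_⟩
  have h1 := hR (subset_tsupport _ h)
  rw [mem_closedBall_zero_iff, Prod.norm_def, max_le_iff] at h1
  exact ⟨abs_le.1 h1.1, abs_le.1 h1.2⟩

/-- Purely qualitative: `M` depends on `λ` and only justifies measurability, integrability and
Fubini. It is finite because `1 - φ` removes the singularity on the diagonal. -/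
theorem exists_isBoxKernel_baseKernel (n : ℕ) (a : ℕ → ℝ) {μ E : ℝ} (hμ0 : 0 < μ)
    {K : ℝ → ℝ → ℂ} (hK : IsSingularKernel μ E K) {φ : ℝ → ℝ} (hφ : IsCutoff φ)
    {ψ : ℝ × ℝ → ℂ} (hψ : ContDiff ℝ ∞ ψ) (hψc : HasCompactSupport ψ) {z : ℂ}
    (hz : z.re = 1 / 2) {lam : ℝ} (hlam : 0 < lam) {R : ℝ}
    (hR : ∀ x y, ψ (x, y) ≠ 0 → x ∈ Set.Icc (-R) R ∧ y ∈ Set.Icc (-R) R) :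
    ∃ M, IsBoxKernel (fun p => baseKernel n (phase n a) K φ ψ z lam p.1 p.2) M R := by
  set L := lam ^ ((1 : ℝ) / n) with hL
  have hL0 : 0 < L := by positivity
  have hE := hK.nonneg
  obtain ⟨B, hB⟩ := hφ.hasCompactSupport.exists_bound_of_continuous hφ.smooth.continuous
  have hB0 : 0 ≤ B := (norm_nonneg _).trans (hB 0)
  have hcH : Continuous fun p : ℝ × ℝ => phaseD n a 1 1 p.1 p.2 := continuous_phaseD n a 1 1
  obtain ⟨N, hN⟩ := (hψc.mul_left
    (f := fun p : ℝ × ℝ => ((√|phaseD n a 1 1 p.1 p.2| : ℝ) : ℂ))).exists_bound_of_continuous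
    ((Complex.continuous_ofReal.comp (hcH.abs.sqrt)).mul hψ.continuous)
  have hcut : ∀ x y, ‖K x y * ((1 - φ ((x - y) * L) : ℝ) : ℂ)‖ ≤
      E * (1 / (2 * L)) ^ (-μ) * (1 + B) := by
    intro x y
    by_cases h : |(x - y) * L| ≤ 1 / 2
    · rw [hφ.eq_one _ h, sub_self, Complex.ofReal_zero, mul_zero, norm_zero]
      positivity
    · rw [not_le, abs_mul, abs_of_pos hL0] at h
      have h1 : 1 / (2 * L) ≤ |x - y| := by
        rw [div_le_iff₀ (by positivity)]; linarith
      have hne : x ≠ y := by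
        rintro rfl
        rw [sub_self, abs_zero, zero_mul] at h
        linarith
      rw [norm_mul, Complex.norm_real]
      gcongr
      · refine (hK.bound x y hne).trans ?_
        refine mul_le_mul_of_nonneg_left ?_ hE
        exact Real.rpow_le_rpow_of_nonpos (by positivity) h1 (by linarith)
      · refine (norm_sub_le _ _).trans ?_
        rw [norm_one]
        have := hB ((x - y) * L)
        linarith
  refine ⟨E * (1 / (2 * L)) ^ (-μ) * (1 + B) * N, ?_, ?_, ?_⟩
  -- Nothing is known of `K` on the diagonal, but the cut-off factor vanishes there, so `K` may be
  -- replaced by its restriction to the complement.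
  · have hKm : Measurable fun p : ℝ × ℝ =>
        K p.1 p.2 * ((1 - φ ((p.1 - p.2) * L) : ℝ) : ℂ) := by
      have hs : MeasurableSet {p : ℝ × ℝ | p.1 ≠ p.2} :=
        (isOpen_ne_fun continuous_fst continuous_snd).measurableSet
      have h1 : Measurable ({p : ℝ × ℝ | p.1 ≠ p.2}.indicator fun p => K p.1 p.2) := by
        classical
        rw [← Set.piecewise_eq_indicator]
        exact hK.contDiffOn.continuousOn.measurable_piecewise continuousOn_const hs
      have h2 : Continuous fun p : ℝ × ℝ => ((1 - φ ((p.1 - p.2) * L) : ℝ) : ℂ) := by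
        have := hφ.smooth.continuous
        fun_prop
      convert h1.mul h2.measurable using 1
      funext p
      by_cases hp : p.1 = p.2
      · have : φ ((p.1 - p.2) * L) = 1 := hφ.eq_one _ (by rw [hp]; norm_num)
        simp [this]
      · rw [Pi.mul_apply, Set.indicator_of_mem hp]
    have hHm : Measurable fun p : ℝ × ℝ =>
        ((|mixedHessian (phase n a) p.1 p.2| : ℝ) : ℂ) ^ z := by
      simp only [mixedHessian_phase]
      exact (Complex.continuous_ofReal.comp hcH.abs).measurable.pow_const z
    have hEm : Measurable fun p : ℝ × ℝ =>
        Complex.exp (Complex.I * ((lam * phase n a p.1 p.2 : ℝ) : ℂ)) := by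
      simp only [← phaseD_zero_zero]
      have := continuous_phaseD n a 0 0
      have h1 : Continuous fun p : ℝ × ℝ =>
        Complex.exp (Complex.I * ((lam * phaseD n a 0 0 p.1 p.2 : ℝ) : ℂ)) := by fun_prop
      exact h1.measurable
    convert (hEm.mul (hKm.mul hHm)).mul hψ.continuous.measurable using 1
    funext p
    simp only [baseKernel, amplitude, Pi.mul_apply, hL]
    ring
  · rintro ⟨x, y⟩
    have e : baseKernel n (phase n a) K φ ψ z lam x y =
        Complex.exp (Complex.I * ((lam * phase n a x y : ℝ) : ℂ)) *
          ((K x y * ((1 - φ ((x - y) * L) : ℝ) : ℂ)) *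
          (((|phaseD n a 1 1 x y| : ℝ) : ℂ) ^ z * ψ (x, y))) := by
      simp only [baseKernel, amplitude, hL, mixedHessian_phase]
      ring
    simp only
    rw [e, norm_mul, mul_comm Complex.I, Complex.norm_exp_ofReal_mul_I, one_mul, norm_mul]
    refine mul_le_mul (hcut x y) ?_ (norm_nonneg _) (by positivity)
    refine le_trans (le_of_eq ?_) (hN (x, y))
    rw [norm_mul, Pi.mul_apply, norm_mul,
      Complex.norm_cpow_eq_rpow_re_of_nonneg (abs_nonneg _) (by rw [hz]; norm_num), hz,
      Complex.norm_real, Real.norm_of_nonneg (Real.sqrt_nonneg _), Real.sqrt_eq_rpow]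
  · intro x y h
    refine hR x y fun h0 => h ?_
    simp [baseKernel, amplitude, h0]

theorem IsBoxKernel.mul_real {b : ℝ × ℝ → ℂ} {M R P : ℝ} (hb : IsBoxKernel b M R)
    {q : ℝ × ℝ → ℝ} (hq : Measurable q) (hqP : ∀ p, |q p| ≤ P) :
    IsBoxKernel (fun p => b p * (q p : ℂ)) (M * P) R where
  measurable := hb.measurable.mul (Complex.measurable_ofReal.comp hq)
  bound p := by
    rw [norm_mul, Complex.norm_real]
    exact mul_le_mul (hb.bound p) (hqP p) (norm_nonneg _) hb.nonneg
  supp x y h := hb.supp x y (left_ne_zero_of_mul h)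

/-- Since `0 < x ≤ y`, the cut-off forces `y λ^{1/n} > 1/2`, and `2^k y ≤ 2` then gives `2^k < 4
λ^{1/n}`. The support of `ψ` only bounds `k` from below. -/
theorem exists_frequency_range (n : ℕ) {φ : ℝ → ℝ} (hφ : IsCutoff φ) {lam R : ℝ} (hlam : 0 < lam)
    (hR : 0 < R) :
    ∃ k₀ k₁ : ℤ, (2 : ℝ) ^ k₁ ≤ 4 * lam ^ ((1 : ℝ) / n) ∧
      ∀ (𝒦 : ℝ) (k : ℤ) (x y : ℝ), 8 ≤ (2 : ℝ) ^ 𝒦 → φ ((x - y) * lam ^ ((1 : ℝ) / n)) ≠ 1 →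
        y ∈ Set.Icc (-R) R → 0 < x → x * (2 : ℝ) ^ 𝒦 ≤ 2 * ((2 : ℝ) ^ k)⁻¹ →
        1 / 2 ≤ (2 : ℝ) ^ k * y → (2 : ℝ) ^ k * y ≤ 2 → k ∈ Finset.Icc k₀ k₁ := by
  set L := lam ^ ((1 : ℝ) / n)
  have hL : 0 < L := by positivity
  obtain ⟨k₀, h1, -⟩ := exists_mem_Ico_zpow (x := 1 / (2 * R)) (y := (2 : ℝ)) (by positivity)
    (by norm_num)
  obtain ⟨k₁, h2, h3⟩ := exists_mem_Ico_zpow (x := 4 * L) (y := (2 : ℝ)) (by positivity)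
    (by norm_num)
  refine ⟨k₀, k₁, h2, ?_⟩
  intro 𝒦 k x y h𝒦 hφ1 hy hx hx𝒦 hl hu
  have hk : 0 < (2 : ℝ) ^ k := by positivity
  rw [Finset.mem_Icc]
  constructor
  · have : (2 : ℝ) ^ k₀ ≤ (2 : ℝ) ^ k := by
      refine h1.trans ?_
      rw [div_le_iff₀ (by positivity)]
      nlinarith [hy.2]
    exact (zpow_le_zpow_iff_right₀ (by norm_num : (1 : ℝ) < 2)).1 this
  · have h4 : 1 / 2 < |(x - y) * L| := by
      by_contra h
      exact hφ1 (hφ.eq_one _ (not_lt.1 h))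
    have hxy : x ≤ y := by
      rw [← div_eq_mul_inv, le_div_iff₀ hk] at hx𝒦
      have h5 : 0 < x * (2 : ℝ) ^ k := by positivity
      have h6 : x * (2 : ℝ) ^ k * 8 ≤ 2 := by nlinarith
      have h7 : (2 : ℝ) ^ k * x ≤ (2 : ℝ) ^ k * y := by linarith
      exact le_of_mul_le_mul_left h7 hk
    rw [abs_mul, abs_of_pos hL, abs_of_nonpos (by linarith)] at h4
    have : (2 : ℝ) ^ k < (2 : ℝ) ^ (k₁ + 1) := by
      refine lt_trans ?_ h3
      have h5 : 1 / 2 < y * L := lt_of_lt_of_le h4 (by gcongr; linarith)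
      nlinarith [mul_lt_mul_of_pos_left h5 hk]
    have := (zpow_lt_zpow_iff_right₀ (by norm_num : (1 : ℝ) < 2)).1 this
    omega

/-- The ratio `2^μ` exceeds `1`, so the sum is of the order of its last term, `λ^{-1/2}
(λ^{1/n})^μ`. -/
theorem sum_dyadic_norms_le (n : ℕ) {μ C lam : ℝ} (hμ0 : 0 < μ) (hμ1 : μ < 1) (hC : 0 ≤ C)
    (hlam : 0 < lam) {k₀ k₁ : ℤ} (hk : (2 : ℝ) ^ k₁ ≤ 4 * lam ^ ((1 : ℝ) / n)) :
    ∑ k ∈ Finset.Icc k₀ k₁, C * (lam ^ (-(1 / 2) : ℝ) * ((2 : ℝ) ^ k) ^ μ) ≤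
      C * (2 ^ μ / (2 ^ μ - 1)) * 4 * lam ^ (μ / n - 1 / 2) := by
  have hr : 1 < (2 : ℝ) ^ μ := Real.one_lt_rpow (by norm_num) hμ0
  have hr' : 0 < (2 : ℝ) ^ μ - 1 := by linarith
  have e : ∀ k : ℤ, ((2 : ℝ) ^ k) ^ μ = ((2 : ℝ) ^ μ) ^ k := fun k => by
    rw [← Real.rpow_intCast, ← Real.rpow_intCast, ← Real.rpow_mul (by norm_num),
      ← Real.rpow_mul (by norm_num), mul_comm]
  have h1 : ((2 : ℝ) ^ k₁) ^ μ ≤ 4 * lam ^ (μ / n) := by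
    calc ((2 : ℝ) ^ k₁) ^ μ ≤ (4 * lam ^ ((1 : ℝ) / n)) ^ μ := by gcongr
      _ = 4 ^ μ * lam ^ (μ / n) := by
        rw [Real.mul_rpow (by norm_num) (by positivity), ← Real.rpow_mul hlam.le]
        congr 2
        ring
      _ ≤ 4 ^ (1 : ℝ) * lam ^ (μ / n) := by
        gcongr
        norm_num
      _ = _ := by rw [Real.rpow_one]
  rw [← Finset.mul_sum, ← Finset.mul_sum]
  simp only [e]
  have h2 := sum_Icc_zpow_le hr k₀ k₁
  rw [← e k₁] at h2
  calc _ ≤ C * (lam ^ (-(1 / 2) : ℝ) * (2 ^ μ / (2 ^ μ - 1) * (4 * lam ^ (μ / n)))) := by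
        gcongr
        exact h2.trans (by gcongr)
    _ = _ := by
        rw [sub_eq_add_neg (μ / n), Real.rpow_add hlam]
        ring

/-! ### The two operator estimates -/

section Estimates

variable (n : ℕ) {μ κ E : ℝ} {φ Ψ : ℝ → ℝ} {ψ : ℝ × ℝ → ℂ} {z : ℂ}

theorem baseKernel_ne {S : ℝ → ℝ → ℝ} {K : ℝ → ℝ → ℂ} {lam x y : ℝ}
    (h : baseKernel n S K φ ψ z lam x y ≠ 0) :
    φ ((x - y) * lam ^ ((1 : ℝ) / n)) ≠ 1 ∧ ψ (x, y) ≠ 0 := by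
  constructor
  · intro h0
    exact h (by unfold baseKernel amplitude; rw [h0]; simp)
  · intro h0
    exact h (by simp [baseKernel, amplitude, h0])

theorem exists_hasL2Bound_indexY (hμ0 : 0 < μ) (hμ1 : μ < 1) (hκ : 1 ≤ κ) (hφ : IsCutoff φ)
    (hΨ : IsDyadicPartition Ψ) (hψ : ContDiff ℝ ∞ ψ) (hψc : HasCompactSupport ψ)
    (hz : z.re = 1 / 2) :
    ∃ C, 0 < C ∧ ∀ (𝒦 : ℝ) (r : ℕ) (Q : Fin r → QuadraticForm ℝ (ℝ × ℝ)) (s : ℕ)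
      (α : Fin s → ℝ) (m : Fin s → ℕ) (c : ℝ) (a : ℕ → ℝ),
      HessianFactors n (phase n a) c α m Q → DominatesLines 𝒦 α → (∀ l, FormBound 𝒦 κ (Q l)) →
      ∀ K : ℝ → ℝ → ℂ, IsSingularKernel μ E K → ∀ lam : ℝ, 0 < lam →
      HasL2Bound (indexY 𝒦) (dampedKernel n (phase n a) K φ Ψ ψ z lam)
        (C * lam ^ (μ / n - 1 / 2)) := by
  obtain ⟨P, hP0, hP⟩ := hΨ.exists_bound
  obtain ⟨C, hC0, hC⟩ := exists_schur_majorant n (E := E) (P := 3 * P) hμ0 hμ1 hκ (by positivity)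
    hφ hΨ hψ hψc hz
  obtain ⟨R, hR0, hR⟩ := exists_support_radius hψc
  have hr : 0 < (2 : ℝ) ^ μ - 1 := by
    have := Real.one_lt_rpow (by norm_num : (1 : ℝ) < 2) hμ0
    linarith
  refine ⟨C * (2 ^ μ / (2 ^ μ - 1)) * 4, by positivity, ?_⟩
  intro 𝒦 r Q s α m c a hH hα hQ K hK lam hlam
  obtain ⟨M, hM⟩ := exists_isBoxKernel_baseKernel n a hμ0 hK hφ hψ hψc hz hlam hR
  obtain ⟨k₀, k₁, hk₁, hk⟩ := exists_frequency_range n hφ hlam hR0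
  have hχ := fun k x => hΨ.abs_dyadicTail_le hP 𝒦 k x
  have hκb : ∀ k : ℤ, IsBoxKernel (fun p => baseKernel n (phase n a) K φ ψ z lam p.1 p.2 *
      ((dyadicTail Ψ 𝒦 k p.1 * Ψ ((2 : ℝ) ^ k * p.2) : ℝ) : ℂ)) (M * (3 * P * P)) R := fun k => by
    refine hM.mul_real (q := fun p => dyadicTail Ψ 𝒦 k p.1 * Ψ ((2 : ℝ) ^ k * p.2)) ?_ fun p => ?_
    · exact ((measurable_dyadicTail hΨ 𝒦 k).comp measurable_fst).mul
        (hΨ.smooth.continuous.comp (continuous_const.mul continuous_snd)).measurable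
    · rw [abs_mul]
      exact mul_le_mul (hχ k _) (hP _) (abs_nonneg _) (by positivity)
  refine hasL2Bound_of_hasSum hM hΨ (fun j k x y => dampedKernel_eq n _ K φ Ψ ψ z lam j k x y)
    (Finset.Icc k₀ k₁) hκb ?_ (fun k => ?_) (fun k _ f hf => ?_)
    (sum_dyadic_norms_le n hμ0 hμ1 hC0.le hlam hk₁)
  · intro x y
    simp only [dampedKernel_eq]
    rw [← Finset.mul_sum, ← Complex.ofReal_sum]
    by_cases h0 : baseKernel n (phase n a) K φ ψ z lam x y = 0
    · simp only [h0, zero_mul]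
      exact hasSum_zero
    · obtain ⟨b1, b2⟩ := baseKernel_ne n h0
      refine (Complex.hasSum_ofReal.2 (hΨ.hasSum_indexY 𝒦 x y fun k h1 h2 => ?_)).mul_left _
      obtain ⟨c1, c2⟩ := hΨ.dyadicTail_ne h1
      obtain ⟨-, c3, c4⟩ := hΨ.pos_of_ne h2
      exact hk 𝒦 k x y hα.1 b1 (hR x y b2).2 c1 c2 c3 c4
  · positivity
  · obtain ⟨w, hw1, hw2, hw3, hw4⟩ := hC 𝒦 r Q s α m c a hH hα hQ K hK lam hlam k
      (dyadicTail Ψ 𝒦 k) (hχ k) fun x => hΨ.dyadicTail_ne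
    exact (hκb k).eLpNorm_le_of_comp_adjoint hw1 hw2 hw4 (by positivity) hw3 hf

theorem exists_hasL2Bound_indexX (hμ0 : 0 < μ) (hμ1 : μ < 1) (hκ : 1 ≤ κ) (hφ : IsCutoff φ)
    (hΨ : IsDyadicPartition Ψ) (hψ : ContDiff ℝ ∞ ψ) (hψc : HasCompactSupport ψ)
    (hz : z.re = 1 / 2) :
    ∃ C, 0 < C ∧ ∀ (𝒦 : ℝ) (r : ℕ) (Q : Fin r → QuadraticForm ℝ (ℝ × ℝ)) (s : ℕ)
      (α : Fin s → ℝ) (m : Fin s → ℕ) (c : ℝ) (a : ℕ → ℝ),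
      HessianFactors n (phase n a) c α m Q → DominatesLines 𝒦 α →
      (∀ l, FormBound 𝒦 κ (swapForm (Q l))) →
      ∀ K : ℝ → ℝ → ℂ, IsSingularKernel μ E K → ∀ lam : ℝ, 0 < lam →
      HasL2Bound (indexX 𝒦) (dampedKernel n (phase n a) K φ Ψ ψ z lam)
        (C * lam ^ (μ / n - 1 / 2)) := by
  have hψs : ContDiff ℝ ∞ fun p : ℝ × ℝ => ψ (p.2, p.1) :=
    hψ.comp (contDiff_snd.prodMk contDiff_fst)
  have hψsc : HasCompactSupport fun p : ℝ × ℝ => ψ (p.2, p.1) :=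
    hψc.comp_homeomorph (Homeomorph.prodComm ℝ ℝ)
  obtain ⟨P, hP0, hP⟩ := hΨ.exists_bound
  obtain ⟨C, hC0, hC⟩ := exists_schur_majorant n (E := E) (P := 3 * P) hμ0 hμ1 hκ (by positivity)
    hφ.comp_neg hΨ hψs hψsc hz
  obtain ⟨R, hR0, hR⟩ := exists_support_radius hψc
  have hr : 0 < (2 : ℝ) ^ μ - 1 := by
    have := Real.one_lt_rpow (by norm_num : (1 : ℝ) < 2) hμ0
    linarith
  refine ⟨C * (2 ^ μ / (2 ^ μ - 1)) * 4, by positivity, ?_⟩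
  intro 𝒦 r Q s α m c a hH hα hQ K hK lam hlam
  obtain ⟨M, hM⟩ := exists_isBoxKernel_baseKernel n a hμ0 hK hφ hψ hψc hz hlam hR
  obtain ⟨k₀, k₁, hk₁, hk⟩ := exists_frequency_range n hφ.comp_neg hlam hR0
  have hχ := fun k x => hΨ.abs_dyadicTail_le hP 𝒦 k x
  have hκb : ∀ k : ℤ, IsBoxKernel (fun p => baseKernel n (phase n a) K φ ψ z lam p.1 p.2 *
      ((dyadicTail Ψ 𝒦 k p.2 * Ψ ((2 : ℝ) ^ k * p.1) : ℝ) : ℂ)) (M * (3 * P * P)) R := fun k => by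
    refine hM.mul_real (q := fun p => dyadicTail Ψ 𝒦 k p.2 * Ψ ((2 : ℝ) ^ k * p.1)) ?_ fun p => ?_
    · exact ((measurable_dyadicTail hΨ 𝒦 k).comp measurable_snd).mul
        (hΨ.smooth.continuous.comp (continuous_const.mul continuous_fst)).measurable
    · rw [abs_mul]
      exact mul_le_mul (hχ k _) (hP _) (abs_nonneg _) (by positivity)
  refine hasL2Bound_of_hasSum hM hΨ (fun j k x y => dampedKernel_eq n _ K φ Ψ ψ z lam j k x y)
    (Finset.Icc k₀ k₁) hκb ?_ (fun k => ?_) (fun k _ f hf => ?_)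
    (sum_dyadic_norms_le n hμ0 hμ1 hC0.le hlam hk₁)
  · intro x y
    simp only [dampedKernel_eq]
    rw [← Finset.mul_sum, ← Complex.ofReal_sum]
    by_cases h0 : baseKernel n (phase n a) K φ ψ z lam x y = 0
    · simp only [h0, zero_mul]
      exact hasSum_zero
    · obtain ⟨-, b2⟩ := baseKernel_ne n h0
      -- After the exchange the cut-off condition reads as one on `φ(-t)` at `y - x`, the form in
      -- which the frequency range was obtained.
      rw [baseKernel_swap] at h0
      obtain ⟨b1, -⟩ := baseKernel_ne n h0
      refine (Complex.hasSum_ofReal.2 (hΨ.hasSum_indexX 𝒦 x y fun k h1 h2 => ?_)).mul_left _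
      obtain ⟨c1, c2⟩ := hΨ.dyadicTail_ne h1
      obtain ⟨-, c3, c4⟩ := hΨ.pos_of_ne h2
      exact hk 𝒦 k y x hα.1 b1 (hR x y b2).1 c1 c2 c3 c4
  · positivity
  · obtain ⟨w, hw1, hw2, hw3, hw4⟩ := hC 𝒦 r (fun l => swapForm (Q l)) s (fun l => (α l)⁻¹) m _ _
      hH.swap (hα.swap hH.α_ne) hQ _ hK.swap lam hlam k (dyadicTail Ψ 𝒦 k) (hχ k)
      fun x => hΨ.dyadicTail_ne
    -- The `T*T` kernel of this piece is the `TT*` kernel of the piece with the variables exchanged.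
    refine (hκb k).eLpNorm_le_of_adjoint_comp hw1 hw2 (fun y y' => ?_) (by positivity) hw3 hf
    simp only [baseKernel_swap n a K]
    exact hw4 y y'

theorem HasL2Bound.mono {J : Set (ℤ × ℤ)} {ker : ℤ → ℤ → ℝ → ℝ → ℂ} {B B' : ℝ}
    (h : HasL2Bound J ker B) (hB : B ≤ B') : HasL2Bound J ker B' := by
  intro f hf
  obtain ⟨h1, h2, h3, h4⟩ := h f hf
  exact ⟨h1, h2, h3, h4.trans (by gcongr)⟩

theorem exists_dampedL2Estimate (E : ℝ) (hμ0 : 0 < μ) (hμ1 : μ < 1) (hκ : 1 ≤ κ)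
    (hφ : IsCutoff φ) (hΨ : IsDyadicPartition Ψ) (hψ : ContDiff ℝ ∞ ψ)
    (hψc : HasCompactSupport ψ) (hz : z.re = 1 / 2) :
    ∃ C, 0 < C ∧ ∀ (𝒦 : ℝ) (r : ℕ) (Q : Fin r → QuadraticForm ℝ (ℝ × ℝ)),
      ((∀ l, (Q l).PosDef) → ∀ l, FormBound 𝒦 κ (Q l) ∧ FormBound 𝒦 κ (swapForm (Q l))) →
      DampedL2Estimate n μ E 𝒦 φ Ψ ψ z Q C := by
  obtain ⟨C1, hC1, h1⟩ := exists_hasL2Bound_indexY n (E := E) hμ0 hμ1 hκ hφ hΨ hψ hψc hz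
  obtain ⟨C2, hC2, h2⟩ := exists_hasL2Bound_indexX n (E := E) hμ0 hμ1 hκ hφ hΨ hψ hψc hz
  refine ⟨C1 + C2, by positivity, ?_⟩
  intro 𝒦 r Q hQ s α m c a hH hα K hK lam hlam
  have hQ' := hQ hH.posDef
  constructor
  · refine (h1 𝒦 r Q s α m c a hH hα (fun l => (hQ' l).1) K hK lam hlam).mono ?_
    gcongr
    linarith
  · refine (h2 𝒦 r Q s α m c a hH hα (fun l => (hQ' l).2) K hK lam hlam).mono ?_
    gcongr
    linarith

end Estimates

theorem theorem3p1 (n : ℕ) (μ E 𝒦 : ℝ) (hμ0 : 0 < μ) (hμ1 : μ < 1)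
    (φ Ψ : ℝ → ℝ) (hφ : IsCutoff φ) (hΨ : IsDyadicPartition Ψ)
    (ψ : ℝ × ℝ → ℂ) (hψ : ContDiff ℝ ∞ ψ) (hψc : HasCompactSupport ψ)
    (z : ℂ) (hz : z.re = 1 / 2) :
    (∃ C : ℝ, 0 < C ∧ ∀ (r : ℕ) (Q : Fin r → QuadraticForm ℝ (ℝ × ℝ)),
      DominatesForms 𝒦 Q → DampedL2Estimate n μ E 𝒦 φ Ψ ψ z Q C) ∧
    (∀ (r : ℕ) (Q : Fin r → QuadraticForm ℝ (ℝ × ℝ)),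
      ∃ C : ℝ, 0 < C ∧ DampedL2Estimate n μ E 𝒦 φ Ψ ψ z Q C) := by
  constructor
  · obtain ⟨C, hC, h⟩ := exists_dampedL2Estimate n (κ := 4) E hμ0 hμ1 (by norm_num) hφ hΨ hψ hψc hz
    refine ⟨C, hC, fun r Q hQ => h 𝒦 r Q fun hpos l => ?_⟩
    exact ⟨formBound_of_dominates (hpos l) (hQ l).1,
      formBound_of_dominates (swapForm_posDef (hpos l)) (hQ l).2⟩
  · intro r Q
    obtain ⟨κ, hκ, hQ⟩ : ∃ κ, 1 ≤ κ ∧ ((∀ l, (Q l).PosDef) →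
        ∀ l, FormBound 𝒦 κ (Q l) ∧ FormBound 𝒦 κ (swapForm (Q l))) := by
      by_cases hpos : ∀ l, (Q l).PosDef
      · choose u hu using fun l => exists_formBound 𝒦 (hpos l)
        choose v hv using fun l => exists_formBound 𝒦 (swapForm_posDef (hpos l))
        have hle : ∀ l, |u l| + |v l| ≤ ∑ l, (|u l| + |v l|) := fun l =>
          Finset.single_le_sum (f := fun l => |u l| + |v l|) (fun l _ => by positivity)
            (Finset.mem_univ l)
        refine ⟨1 + ∑ l, (|u l| + |v l|),
          le_add_of_nonneg_right (Finset.sum_nonneg fun l _ => by positivity), fun _ l =>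
          ⟨(hu l).mono (hpos l) ?_, (hv l).mono (swapForm_posDef (hpos l)) ?_⟩⟩
        · linarith [hle l, le_abs_self (u l), abs_nonneg (v l)]
        · linarith [hle l, le_abs_self (v l), abs_nonneg (u l)]
      -- If some form is not positive definite, no phase has these factors and any `κ` will do.
      · exact ⟨1, le_rfl, fun h => absurd h hpos⟩
    obtain ⟨C, hC, h⟩ := exists_dampedL2Estimate n (κ := κ) E hμ0 hμ1 hκ hφ hΨ hψ hψc hz
    exact ⟨C, hC, h 𝒦 r Q hQ⟩
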